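/- Corollary 3. All graphs are finite and simple. The conditional independencies encoded by a DAG $D$ are the triples $(X,Y,Z)$ of pairwise disjoint vertex sets such that $Z$ d-separates $X$ from $Y$ in $D$; two DAGs on the same vertex set are Markov equivalent if they encode the same conditional independencies. The essential graph of a DAG $D$ has the same skeleton as $D$, and an edge is directed in it if and only if that edge has the same orientation in every DAG Markov equivalent to $D$; otherwise the edge is undirected. For an undirected graph $\mathcal U$, let $\mathrm{Size}(\mathcal U)$ be the size of the Markov equivalence class represented by $\mathcal U$, i.e. the number of DAGs on the vertex set of $\mathcal U$ whose essential graph is $\mathcal U$. For an undirected chordal graph $\mathcal K$ (every cycle with four or more vertices has a chord; $\mathcal K$ need not be connected) and an integer $m\ge 0$, let $\mathcal K^{m+}$ be the graph obtained from $\mathcal K$ by adding $m$ new vertices, each adjacent to all other vertices, and put $f(\mathcal K,m)=\mathrm{Size}(\mathcal K^{m+})$. Let $\mathcal K$ be an undirected chordal graph with $p$ vertices. Then for every integer $m\ge 0$: 1. if $\mathcal K$ is the null graph (the graph without vertices), then $f(\mathcal K,m)=m!$; 2. if $\mathcal K$ is a tree, then $f(\mathcal K,m)=\left[(p-1)m^2+(2p-1)m+p\right]m!$;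 3. if $\mathcal K$ is a tree plus, i.e. a tree together with one additional edge joining two distinct non-adjacent vertices of the tree, then $f(\mathcal K,m)=\left[m^3+2pm^2+(4p-1)m+2p\right]m!$; 4. if $\mathcal K$ is composed of isolated edges, i.e. every vertex lies on exactly one edge, then $f(\mathcal K,m)=2^{p/2-1}\left(\frac{pm^2}{2}+\frac{3pm}{2}+2\right)m!$. -/

import Mathlib

open scoped Nat

namespace MarkovSize

variable {V : Type*}

/-- An undirected graph is chordal if every cycle with four or more vertices has a chord. -/
def IsChordal (G : SimpleGraph V) : Prop :=
  ∀ (v : V) (c : G.Walk v v), c.IsCycle → 4 ≤ c.length → ∃ e, c.IsChord e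

/-- A tree plus graph: a tree together with one additional edge. -/
def IsTreePlus (G : SimpleGraph V) : Prop :=
  ∃ (T : SimpleGraph V) (a b : V),
    T.IsTree ∧ a ≠ b ∧ ¬ T.Adj a b ∧ G = T ⊔ SimpleGraph.edge a b

/-- A graph composed of isolated edges: every vertex lies on exactly one edge. -/
def IsIsolatedEdges (G : SimpleGraph V) : Prop :=
  ∀ v, ∃! w, G.Adj v w

/-- A directed graph without directed cycles (in particular without loops). -/
def IsDAG (D : Digraph V) : Prop :=
  ∀ v, ¬ Relation.TransGen D.Adj v v

/-- The skeleton of a directed graph. -/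
abbrev skeleton (D : Digraph V) : SimpleGraph V :=
  D.toSimpleGraphInclusive

/-- A path `q` of the skeleton of `D` is blocked by `Z` if it has an inner vertex `b`, with
neighbours `a` and `c` on the path, such that either `a → b ← c` and neither `b` nor any
descendant of `b` is in `Z`, or `b` is not such a collider and `b ∈ Z`. -/
def Blocked (D : Digraph V) (Z : Set V) {x y : V} (q : (skeleton D).Walk x y) : Prop :=
  ∃ i, i + 2 ≤ q.length ∧
    let a := q.getVert i
    let b := q.getVert (i + 1)
    let c := q.getVert (i + 2)
    ((D.Adj a b ∧ D.Adj c b) ∧ ∀ d, Relation.ReflTransGen D.Adj b d → d ∉ Z) ∨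
      (¬ (D.Adj a b ∧ D.Adj c b) ∧ b ∈ Z)

/-- d-separation: every path between `X` and `Y` is blocked by `Z`. -/
def DSep (D : Digraph V) (X Y Z : Set V) : Prop :=
  ∀ x ∈ X, ∀ y ∈ Y, ∀ q : (skeleton D).Walk x y, q.IsPath → Blocked D Z q

/-- The set of conditional independencies "`X` independent of `Y` given `Z`" encoded by `D`, for
pairwise disjoint sets of vertices. -/
def condIndep (D : Digraph V) : Set (Set V × Set V × Set V) :=
  {t | Disjoint t.1 t.2.1 ∧ Disjoint t.1 t.2.2 ∧ Disjoint t.2.1 t.2.2 ∧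
    DSep D t.1 t.2.1 t.2.2}

/-- Markov equivalence: the same conditional independencies are encoded. -/
def MarkovEquiv (D D' : Digraph V) : Prop :=
  condIndep D = condIndep D'

/-- Graphs whose edges may be directed (`u → v`) or undirected (`u - v`). -/
@[ext]
structure MixedGraph (V : Type*) where
  /-- There is a directed edge from the first vertex to the second one. -/
  dir : V → V → Prop
  /-- There is an undirected edge between the two vertices. -/
  undir : V → V → Prop

/-- An undirected graph as a mixed graph. -/
def ofUndirected (G : SimpleGraph V) : MixedGraph V where
  dir _ _ := False
  undir := G.Adj

/-- The essential graph of (the Markov equivalence class of) a DAG `D`: it has the skeleton of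
`D`, and an edge is directed in it if and only if the edge has the same orientation in every DAG
that is Markov equivalent to `D`. -/
def essentialGraph (D : Digraph V) : MixedGraph V where
  dir u v := (skeleton D).Adj u v ∧ ∀ D', IsDAG D' → MarkovEquiv D D' → D'.Adj u v
  undir u v := (skeleton D).Adj u v ∧
    ¬ (∀ D', IsDAG D' → MarkovEquiv D D' → D'.Adj u v) ∧
    ¬ (∀ D', IsDAG D' → MarkovEquiv D D' → D'.Adj v u)

/-- The Markov equivalence class represented by `C`: the DAGs with essential graph `C`. -/
def markovClass (C : MixedGraph V) : Set (Digraph V) :=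
  {D | IsDAG D ∧ essentialGraph D = C}

/-- The size of the Markov equivalence class represented by `C`. -/
noncomputable def size (C : MixedGraph V) : ℕ :=
  (markovClass C).ncard

/-- The extended graph of `K`: `m` vertices, each adjacent to all other vertices, are added. -/
def extend (K : SimpleGraph V) (m : ℕ) : SimpleGraph (V ⊕ Fin m) :=
  SimpleGraph.fromRel fun s t =>
    match s, t with
    | .inl u, .inl v => K.Adj u v
    | _, _ => True

/-- `f K m` is the size of the Markov equivalence class represented by the graph obtained from
`K` by adding `m` dominating vertices. -/
noncomputable def f (K : SimpleGraph V) (m : ℕ) : ℕ :=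
  size (ofUndirected (extend K m))

end MarkovSize

open scoped Nat

namespace MarkovSize

variable {V : Type*}

theorem skeleton_adj {D : Digraph V} {u v : V} :
    (skeleton D).Adj u v ↔ u ≠ v ∧ (D.Adj u v ∨ D.Adj v u) := Iff.rfl

theorem IsDAG.irrefl {D : Digraph V} (h : IsDAG D) (u : V) : ¬ D.Adj u u :=
  fun h' => h u (.single h')

theorem IsDAG.asymm {D : Digraph V} (h : IsDAG D) {u v : V} (huv : D.Adj u v) : ¬ D.Adj v u :=
  fun h' => h u (.head huv (.single h'))

theorem IsDAG.not_adj_of_reflTransGen {D : Digraph V} (h : IsDAG D) {u v : V}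
    (huv : Relation.ReflTransGen D.Adj u v) : ¬ D.Adj v u :=
  fun h' => h u (Relation.TransGen.tail' huv h')

theorem IsDAG.antisymm {D : Digraph V} (h : IsDAG D) {u v : V}
    (huv : Relation.ReflTransGen D.Adj u v) (hvu : Relation.ReflTransGen D.Adj v u) : u = v := by
  rcases Relation.reflTransGen_iff_eq_or_transGen.1 huv with h1 | h1
  · exact h1.symm
  · exact (h u (h1.trans_left hvu)).elim

theorem IsDAG.of_lt {α : Type*} [Preorder α] {D : Digraph V} (r : V → α)
    (hr : ∀ u v, D.Adj u v → r u < r v) : IsDAG D := by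
  intro v hv
  have : ∀ w, Relation.TransGen D.Adj v w → r v < r w := by
    intro w hw
    induction hw with
    | single h => exact hr _ _ h
    | tail _ h ih => exact ih.trans (hr _ _ h)
  exact lt_irrefl _ (this v hv)

/-- A finite DAG is graded by the number of ancestors of its vertices. -/
theorem IsDAG.exists_rank [Finite V] {D : Digraph V} (h : IsDAG D) :
    ∃ r : V → ℕ, ∀ u v, D.Adj u v → r u < r v := by
  refine ⟨fun v => {u | Relation.TransGen D.Adj u v}.ncard, fun u v huv => ?_⟩
  refine Set.ncard_lt_ncard ⟨fun w hw => Relation.TransGen.tail hw huv, fun hsub => ?_⟩ (Set.toFinite _)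
  exact h u (hsub (Relation.TransGen.single huv))

theorem Blocked.of_reverse {D : Digraph V} {Z : Set V} {x y : V} {q : (skeleton D).Walk x y}
    (h : Blocked D Z q.reverse) : Blocked D Z q := by
  obtain ⟨i, hi, h⟩ := h
  rw [SimpleGraph.Walk.length_reverse] at hi
  refine ⟨q.length - (i + 2), by omega, ?_⟩
  simp only [SimpleGraph.Walk.getVert_reverse] at h
  have e1 : q.length - (i + 2) + 1 = q.length - (i + 1) := by omega
  have e2 : q.length - (i + 2) + 2 = q.length - i := by omega
  simp only [e1, e2]
  simpa only [and_comm] using h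

theorem DSep.symm {D : Digraph V} {X Y Z : Set V} (h : DSep D X Y Z) : DSep D Y X Z :=
  fun x hx y hy q hq => Blocked.of_reverse (h y hy x hx q.reverse hq.reverse)

/-- The parents of a vertex block all paths to its nonadjacent nondescendants. -/
theorem dSep_parents {D : Digraph V} (hD : IsDAG D) {s t : V}
    (hst : ¬ Relation.ReflTransGen D.Adj s t) (hadj : ¬ D.Adj t s) :
    DSep D {s} {t} {b | D.Adj b s} := by
  rintro x (hx : x = s) y (hy : y = t) q -
  subst hx hy
  by_contra hb
  have key : ∀ i ≤ q.length, Relation.ReflTransGen D.Adj x (q.getVert i) ∧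
      ∀ k, k + 1 = i → D.Adj (q.getVert k) (q.getVert i) := by
    intro i
    induction i with
    | zero => simpa using Relation.ReflTransGen.refl
    | succ i ih =>
      intro hi
      obtain ⟨hr, hk⟩ := ih (by omega)
      have hsk := (q.adj_getVert_succ (i := i) (by omega))
      by_cases hd : D.Adj (q.getVert i) (q.getVert (i + 1))
      · refine ⟨hr.tail hd, ?_⟩
        intro k hk
        obtain rfl : k = i := by omega
        exact hd
      · exfalso
        have hd' : D.Adj (q.getVert (i + 1)) (q.getVert i) := hsk.2.resolve_left hd
        apply hb
        rcases i with _ | k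
        · simp only [SimpleGraph.Walk.getVert_zero, zero_add] at hd hd'
          have : q.length ≠ 1 := by
            intro h1
            rw [← h1, SimpleGraph.Walk.getVert_length] at hd'
            exact hadj hd'
          refine ⟨0, by omega, Or.inr ?_⟩
          simp only [SimpleGraph.Walk.getVert_zero, zero_add]
          exact ⟨fun h => hd h.1, hd'⟩
        · refine ⟨k, by omega, Or.inl ⟨⟨hk k rfl, hd'⟩, fun d hd hdx => ?_⟩⟩
          exact hD.not_adj_of_reflTransGen (hr.trans hd) hdx
  have := (key q.length le_rfl).1
  rw [SimpleGraph.Walk.getVert_length] at this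
  exact hst this

theorem exists_dSep {D : Digraph V} (hD : IsDAG D) {s t : V} (hne : s ≠ t)
    (hadj : ¬ (skeleton D).Adj s t) :
    ∃ Z : Set V, s ∉ Z ∧ t ∉ Z ∧ DSep D {s} {t} Z := by
  have h1 : ¬ D.Adj s t := fun h => hadj ⟨hne, .inl h⟩
  have h2 : ¬ D.Adj t s := fun h => hadj ⟨hne, .inr h⟩
  by_cases hst : Relation.ReflTransGen D.Adj s t
  · have hts : ¬ Relation.ReflTransGen D.Adj t s := fun h => hne (hD.antisymm hst h)
    exact ⟨{b | D.Adj b t}, h1, hD.irrefl t, (dSep_parents hD hts h1).symm⟩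
  · exact ⟨{b | D.Adj b s}, hD.irrefl s, h2, dSep_parents hD hst h2⟩

theorem mem_condIndep_singleton {D : Digraph V} {s t : V} {Z : Set V} (hne : s ≠ t)
    (hs : s ∉ Z) (ht : t ∉ Z) : ({s}, {t}, Z) ∈ condIndep D ↔ DSep D {s} {t} Z := by
  simp [condIndep, hne, hs, ht]

theorem MarkovEquiv.dSep_iff {D D' : Digraph V} (h : MarkovEquiv D D') {s t : V} {Z : Set V}
    (hne : s ≠ t) (hs : s ∉ Z) (ht : t ∉ Z) : DSep D {s} {t} Z ↔ DSep D' {s} {t} Z := by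
  rw [← mem_condIndep_singleton hne hs ht, ← mem_condIndep_singleton hne hs ht, h]

theorem not_dSep_of_adj {D : Digraph V} {s t : V} {Z : Set V} (h : (skeleton D).Adj s t) :
    ¬ DSep D {s} {t} Z := by
  intro hs
  obtain ⟨i, hi, -⟩ := hs s rfl t rfl h.toWalk (by simp [SimpleGraph.Walk.isPath_def, h.ne])
  simp at hi

theorem MarkovEquiv.symm {D D' : Digraph V} (h : MarkovEquiv D D') : MarkovEquiv D' D :=
  Eq.symm h

theorem MarkovEquiv.skeleton_le {D D' : Digraph V} (hD' : IsDAG D') (h : MarkovEquiv D D') :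
    skeleton D ≤ skeleton D' := by
  intro s t hst
  by_contra hn
  obtain ⟨Z, hs, ht, hZ⟩ := exists_dSep hD' hst.ne hn
  exact not_dSep_of_adj hst ((h.dSep_iff hst.ne hs ht).2 hZ)

theorem MarkovEquiv.skeleton_eq {D D' : Digraph V} (hD : IsDAG D) (hD' : IsDAG D')
    (h : MarkovEquiv D D') : skeleton D = skeleton D' :=
  le_antisymm (h.skeleton_le hD') (h.symm.skeleton_le hD)

theorem blocked_two {D : Digraph V} {a b c : V} {Z : Set V} (hab : (skeleton D).Adj a b)
    (hbc : (skeleton D).Adj b c) (hac : a ≠ c) (h : DSep D {a} {c} Z) :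
    (D.Adj a b ∧ D.Adj c b ∧ b ∉ Z) ∨ (¬ (D.Adj a b ∧ D.Adj c b) ∧ b ∈ Z) := by
  obtain ⟨i, hi, h⟩ := h a rfl c rfl (.cons hab (.cons hbc .nil))
    (by simp [SimpleGraph.Walk.isPath_def, hab.ne, hbc.ne, hac])
  obtain rfl : i = 0 := by simpa using hi
  rcases h with ⟨h1, h2⟩ | h
  · exact .inl ⟨h1.1, h1.2, h2 b .refl⟩
  · exact .inr h

/-- Markov equivalent DAGs have the same immoralities. -/
theorem MarkovEquiv.collider {D D' : Digraph V} (hD : IsDAG D) (hD' : IsDAG D')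
    (h : MarkovEquiv D D') {a b c : V} (hab : D.Adj a b) (hcb : D.Adj c b) (hne : a ≠ c)
    (hac : ¬ (skeleton D).Adj a c) : D'.Adj a b ∧ D'.Adj c b := by
  obtain ⟨Z, ha, hc, hZ⟩ := exists_dSep hD hne hac
  have e1 : (skeleton D).Adj a b := ⟨fun e => hD.irrefl b (e ▸ hab), .inl hab⟩
  have e2 : (skeleton D).Adj b c := ⟨fun e => hD.irrefl b (e ▸ hcb), .inr hcb⟩
  have hb : b ∉ Z := by
    rcases blocked_two e1 e2 hne hZ with h | h
    · exact h.2.2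
    · exact (h.1 ⟨hab, hcb⟩).elim
  rw [h.dSep_iff hne ha hc] at hZ
  rw [h.skeleton_eq hD hD'] at e1 e2
  rcases blocked_two e1 e2 hne hZ with h | h
  · exact ⟨h.1, h.2.1⟩
  · exact (hb h.2).elim

/-- `D` is an acyclic moral orientation of `G`. -/
structure IsMoralOrientation (G : SimpleGraph V) (D : Digraph V) : Prop where
  dag : IsDAG D
  adj_iff : ∀ u v, G.Adj u v ↔ D.Adj u v ∨ D.Adj v u
  moral : ∀ a b c, D.Adj a b → D.Adj c b → a ≠ c → G.Adj a c

namespace IsMoralOrientation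
variable {G : SimpleGraph V} {D : Digraph V}

theorem skeleton_eq (h : IsMoralOrientation G D) : skeleton D = G := by
  ext u v
  rw [skeleton_adj, h.adj_iff, and_iff_right_iff_imp]
  rintro hh rfl
  exact h.dag.irrefl u (hh.elim id id)

theorem adj (h : IsMoralOrientation G D) {u v : V} (huv : D.Adj u v) : G.Adj u v :=
  (h.adj_iff u v).2 (.inl huv)

theorem adj' (h : IsMoralOrientation G D) {u v : V} (huv : D.Adj u v) : G.Adj v u :=
  (h.adj huv).symm

theorem not_adj (h : IsMoralOrientation G D) {u v : V} (huv : D.Adj u v) : ¬ D.Adj v u :=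
  h.dag.asymm huv

end IsMoralOrientation

/-- The graph obtained from `G` by isolating the vertices in `Z`. -/
def isolate (G : SimpleGraph V) (Z : Set V) : SimpleGraph V where
  Adj u v := G.Adj u v ∧ u ∉ Z ∧ v ∉ Z
  symm := ⟨fun _ _ h => ⟨h.1.symm, h.2.2, h.2.1⟩⟩
  loopless := ⟨fun _ h => G.loopless.irrefl _ h.1⟩

namespace IsMoralOrientation
variable {G : SimpleGraph V} {D : Digraph V}

theorem exists_not_blocked (h : IsMoralOrientation G D) {Z : Set V} {x y : V}
    (hr : (isolate G Z).Reachable x y) :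
    ∃ q : (skeleton D).Walk x y, q.IsPath ∧ ¬ Blocked D Z q := by
  obtain ⟨p, hp, hlen⟩ := hr.exists_path_of_dist
  have hle : isolate G Z ≤ skeleton D := by
    rw [h.skeleton_eq]
    exact fun _ _ h => h.1
  refine ⟨p.mapLe hle, (SimpleGraph.Walk.isPath_mapLe hle).2 hp, ?_⟩
  rintro ⟨i, hi, hb⟩
  have hi' : i + 2 ≤ p.length := by simpa using hi
  simp only [SimpleGraph.Walk.mapLe, SimpleGraph.Walk.getVert_map, SimpleGraph.Hom.coe_ofLE,
    id_eq] at hb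
  have hab := p.adj_getVert_succ (i := i) (by omega)
  have hbc := p.adj_getVert_succ (i := i + 1) (by omega)
  rcases hb with ⟨⟨h1, h2⟩, -⟩ | ⟨-, h2⟩
  · have hne : p.getVert i ≠ p.getVert (i + 2) := by
      intro he
      have := hp.getVert_injOn (by simp; omega) (by simp; omega) he
      omega
    have hac : (isolate G Z).Adj (p.getVert i) (p.getVert (i + 2)) :=
      ⟨h.moral _ _ _ h1 h2 hne, hab.2.1, hbc.2.2⟩
    have := SimpleGraph.dist_le ((p.take i).append (.cons hac (p.drop (i + 2))))
    simp at this
    omega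
  · exact hab.2.2 h2

theorem reachable_of_not_blocked (h : IsMoralOrientation G D) {Z : Set V} {x y : V}
    (hx : x ∉ Z) (hy : y ∉ Z) {q : (skeleton D).Walk x y} (hq : q.IsPath)
    (hb : ¬ Blocked D Z q) : (isolate G Z).Reachable x y := by
  let C : ℕ → Prop := fun i => i + 2 ≤ q.length ∧ D.Adj (q.getVert i) (q.getVert (i + 1)) ∧
    D.Adj (q.getVert (i + 2)) (q.getVert (i + 1))
  have hZ : ∀ n ≤ q.length, (∀ i, i + 1 = n → ¬ C i) → q.getVert n ∉ Z := by
    intro n hn hC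
    rcases n with _ | i
    · simpa using hx
    · rcases hn.eq_or_lt with hl | hl
      · rw [hl, SimpleGraph.Walk.getVert_length]; exact hy
      · intro hz
        exact hb ⟨i, hl, .inr ⟨fun hc => hC i rfl ⟨hl, hc⟩, hz⟩⟩
  have key : ∀ n ≤ q.length, (∀ i, i + 1 = n → ¬ C i) →
      (isolate G Z).Reachable x (q.getVert n) := by
    intro n
    induction n using Nat.strong_induction_on with
    | _ n ih =>
    intro hn hC
    rcases n with _ | i
    · simp
    · by_cases hi : ∀ k, k + 1 = i → ¬ C k
      · refine (ih i (by omega) (by omega) hi).trans (SimpleGraph.Adj.reachable ⟨?_, ?_, ?_⟩)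
        · rw [← h.skeleton_eq]
          exact q.adj_getVert_succ (by omega)
        · exact hZ _ (by omega) hi
        · exact hZ _ hn hC
      · push Not at hi
        obtain ⟨k, rfl, hk⟩ := hi
        have hk' : ∀ j, j + 1 = k → ¬ C j := by
          rintro j rfl hj
          exact h.not_adj hj.2.2 hk.2.1
        refine (ih k (by omega) (by omega) hk').trans (SimpleGraph.Adj.reachable ⟨?_, ?_, ?_⟩)
        · refine h.moral _ _ _ hk.2.1 hk.2.2 fun he => ?_
          have := hq.getVert_injOn (by simp; omega) (by simp; omega) he
          omega
        · exact hZ _ (by omega) hk'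
        · exact hZ _ hn hC
  simpa using key q.length le_rfl (by
    rintro i hi ⟨hc, -⟩
    omega)

/-- In a moral orientation, d-separation is separation in the skeleton. -/
theorem dSep_iff (h : IsMoralOrientation G D) {X Y Z : Set V} (hX : Disjoint X Z)
    (hY : Disjoint Y Z) :
    DSep D X Y Z ↔ ∀ x ∈ X, ∀ y ∈ Y, ¬ (isolate G Z).Reachable x y := by
  constructor
  · intro hs x hx y hy hr
    obtain ⟨q, hq, hb⟩ := h.exists_not_blocked hr
    exact hb (hs x hx y hy q hq)
  · intro hs x hx y hy q hq
    by_contra hb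
    exact hs x hx y hy (h.reachable_of_not_blocked (Set.disjoint_left.1 hX hx)
      (Set.disjoint_left.1 hY hy) hq hb)

theorem markovEquiv {D' : Digraph V} (h : IsMoralOrientation G D) (h' : IsMoralOrientation G D') :
    MarkovEquiv D D' := by
  ext ⟨X, Y, Z⟩
  simp only [condIndep, Set.mem_ofPred_eq]
  refine and_congr_right fun _ => and_congr_right fun hX => and_congr_right fun hY => ?_
  rw [h.dSep_iff hX hY, h'.dSep_iff hX hY]

end IsMoralOrientation

/-- A list is a reverse perfect elimination order if the neighbours of each entry among the later
entries are pairwise adjacent. -/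
def IsPerfectList (G : SimpleGraph V) : List V → Prop
  | [] => True
  | s :: L => s ∉ L ∧ IsPerfectList G L ∧
      ∀ a ∈ L, ∀ b ∈ L, G.Adj s a → G.Adj s b → a ≠ b → G.Adj a b

section PerfectList
variable {G : SimpleGraph V}

theorem IsPerfectList.of_append {A L : List V} (h : IsPerfectList G (A ++ L)) :
    IsPerfectList G L := by
  induction A with
  | nil => exact h
  | cons a A ih => exact ih h.2.1

theorem IsPerfectList.nodup {L : List V} (h : IsPerfectList G L) : L.Nodup := by
  induction L with
  | nil => exact List.nodup_nil
  | cons a A ih => exact List.nodup_cons.2 ⟨h.1, ih h.2.1⟩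

theorem IsPerfectList.append_of_not_adj {s : V} {A M M' : List V}
    (h : IsPerfectList G (A ++ M)) (h' : IsPerfectList G M')
    (hM : ∀ x, x ∈ M' ↔ x = s ∨ x ∈ M) (hs : s ∉ A) (hA : ∀ a ∈ A, ¬ G.Adj a s) :
    IsPerfectList G (A ++ M') := by
  induction A with
  | nil => exact h'
  | cons a A ih =>
    rw [List.cons_append, IsPerfectList] at h ⊢
    obtain ⟨h1, h2, h3⟩ := h
    simp only [List.mem_cons, not_or, forall_eq_or_imp] at hs hA
    refine ⟨?_, ih h2 hs.2 hA.2, ?_⟩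
    · simp only [List.mem_append, hM] at h1 ⊢
      have := hs.1
      tauto
    · intro x hx y hy hax hay
      have hne : ∀ z, G.Adj a z → z ∈ A ++ M' → z ∈ A ++ M := by
        intro z haz hz
        simp only [List.mem_append, hM] at hz ⊢
        rcases hz with hz | rfl | hz
        · exact .inl hz
        · exact (hA.1 haz).elim
        · exact .inr hz
      exact h3 x (hne x hax hx) y (hne y hay hy) hax hay

theorem IsPerfectList.insert_of_adj {s : V} {C l : List V} (h : IsPerfectList G (C ++ l))
    (hs : ∀ x ∈ C ++ l, G.Adj s x) (hl : ∀ a ∈ l, ∀ b ∈ l, a ≠ b → G.Adj a b) :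
    IsPerfectList G (C ++ s :: l) := by
  induction C with
  | nil =>
    exact ⟨fun hmem => G.loopless.irrefl s (hs s hmem), h, fun a ha b hb _ _ => hl a ha b hb⟩
  | cons c C ih =>
    rw [List.cons_append, IsPerfectList] at h ⊢
    obtain ⟨h1, h2, h3⟩ := h
    have hs' : ∀ x ∈ C ++ l, G.Adj s x := fun x hx => hs x (List.mem_cons_of_mem _ hx)
    have hcs : G.Adj s c := hs c (by simp)
    refine ⟨?_, ih h2 hs', ?_⟩
    · have := hcs.ne'
      simp only [List.mem_append, List.mem_cons] at h1 ⊢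
      tauto
    · have hmem : ∀ z, z ∈ C ++ s :: l → z = s ∨ z ∈ C ++ l := by
        intro z
        simp only [List.mem_append, List.mem_cons]
        tauto
      intro x hx y hy hcx hcy hxy
      rcases hmem x hx with rfl | hx' <;> rcases hmem y hy with rfl | hy'
      · exact (hxy rfl).elim
      · exact hs' y hy'
      · exact (hs' x hx').symm
      · exact h3 x hx' y hy' hcx hcy hxy

/-- Every clique can be moved to the end of a perfect list. -/
theorem IsPerfectList.exists_suffix {L : List V} (h : IsPerfectList G L) {l : List V}
    (hl : l.Nodup) (hsub : l ⊆ L) (hc : ∀ a ∈ l, ∀ b ∈ l, a ≠ b → G.Adj a b) :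
    ∃ L', IsPerfectList G (L' ++ l) ∧ ∀ x, x ∈ L' ++ l ↔ x ∈ L := by
  classical
  induction L generalizing l with
  | nil =>
    obtain rfl : l = [] := List.subset_nil.1 hsub
    exact ⟨[], trivial, by simp⟩
  | cons s L ih =>
    obtain ⟨h1, h2, h3⟩ := h
    by_cases hs : s ∈ l
    · obtain ⟨l₂, l₁, rfl⟩ := List.append_of_mem hs
      have hnd : s ∉ l₂ ++ l₁ ∧ (l₂ ++ l₁).Nodup := by
        have := List.nodup_middle.1 hl
        exact List.nodup_cons.1 this
      have hsub' : l₂ ++ l₁ ⊆ L := by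
        intro x hx
        have hxs : x ≠ s := fun e => hnd.1 (e ▸ hx)
        have : x ∈ s :: L := hsub (by simp only [List.mem_append, List.mem_cons] at hx ⊢; tauto)
        exact (List.mem_cons.1 this).resolve_left hxs
      have hadj : ∀ x ∈ l₂ ++ l₁, G.Adj s x := by
        intro x hx
        refine hc s hs x ?_ fun e => hnd.1 (e ▸ hx)
        simp only [List.mem_append, List.mem_cons] at hx ⊢; tauto
      let R := L.filter fun x => G.Adj s x ∧ x ∉ l₂ ++ l₁
      have hR : ∀ x, x ∈ R ↔ x ∈ L ∧ G.Adj s x ∧ x ∉ l₂ ++ l₁ := by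
        intro x; simp only [R, List.mem_filter, decide_eq_true_eq]
      have hmem : ∀ x, x ∈ R ++ (l₂ ++ l₁) → x ∈ L ∧ G.Adj s x := by
        intro x hx
        rcases List.mem_append.1 hx with hx | hx
        · exact ⟨((hR x).1 hx).1, ((hR x).1 hx).2.1⟩
        · exact ⟨hsub' hx, hadj x hx⟩
      obtain ⟨L', hL', hiff⟩ := ih h2 (l := R ++ (l₂ ++ l₁))
        (List.Nodup.append (h2.nodup.filter _) hnd.2 fun x hx hx' => ((hR x).1 hx).2.2 hx')
        (fun x hx => (hmem x hx).1)
        (fun a ha b hb => h3 a (hmem a ha).1 b (hmem b hb).1 (hmem a ha).2 (hmem b hb).2)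
      refine ⟨L' ++ R, ?_, ?_⟩
      · have hM' : IsPerfectList G (R ++ l₂ ++ s :: l₁) := by
          refine IsPerfectList.insert_of_adj ?_ ?_ ?_
          · rw [List.append_assoc]; exact hL'.of_append
          · intro x hx
            rw [List.append_assoc] at hx
            exact (hmem x hx).2
          · exact fun a ha b hb => hc a (by simp [ha]) b (by simp [hb])
        rw [List.append_assoc, ← List.append_assoc R]
        have hL'L : ∀ a ∈ L', a ∈ L := fun a ha => (hiff a).1 (List.mem_append_left _ ha)
        refine hL'.append_of_not_adj (s := s) hM' ?_ (fun hsL => h1 (hL'L s hsL)) ?_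
        · intro x
          simp only [List.mem_append, List.mem_cons]; tauto
        · intro a ha has
          have hdisj := List.disjoint_of_nodup_append hL'.nodup ha
          apply hdisj
          by_cases hal : a ∈ l₂ ++ l₁
          · exact List.mem_append_right _ hal
          · exact List.mem_append_left _ ((hR a).2 ⟨hL'L a ha, has.symm, hal⟩)
      · intro x
        have := hiff x
        simp only [List.mem_append, List.mem_cons] at this ⊢
        tauto
    · obtain ⟨L', hL', hiff⟩ := ih h2 hl
        (fun x hx => (List.mem_cons.1 (hsub hx)).resolve_left fun e => hs (e ▸ hx)) hc
      refine ⟨s :: L', ?_, ?_⟩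
      · rw [List.cons_append, IsPerfectList]
        refine ⟨by rw [hiff]; exact h1, hL', ?_⟩
        intro a ha b hb
        exact h3 a ((hiff a).1 ha) b ((hiff b).1 hb)
      · intro x
        rw [List.cons_append, List.mem_cons, List.mem_cons, hiff]

theorem IsPerfectList.adj_of_idxOf_lt [DecidableEq V] {L : List V} (h : IsPerfectList G L)
    {a b c : V} (ha : a ∈ L) (hc : c ∈ L) (hab : L.idxOf b < L.idxOf a)
    (hcb : L.idxOf b < L.idxOf c) (h1 : G.Adj a b) (h2 : G.Adj c b) (hne : a ≠ c) : G.Adj a c := by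
  induction L with
  | nil => simp at ha
  | cons s L ih =>
    obtain ⟨h3, h4, h5⟩ := h
    have has : s ≠ a := by rintro rfl; simp at hab
    have hcs : s ≠ c := by rintro rfl; simp at hcb
    have ha' : a ∈ L := (List.mem_cons.1 ha).resolve_left has.symm
    have hc' : c ∈ L := (List.mem_cons.1 hc).resolve_left hcs.symm
    by_cases hb : s = b
    · subst hb
      exact h5 a ha' c hc' h1.symm h2.symm hne
    · rw [List.idxOf_cons_ne _ hb] at hab hcb
      rw [List.idxOf_cons_ne _ has] at hab
      rw [List.idxOf_cons_ne _ hcs] at hcb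
      exact ih h4 ha' hc' (by omega) (by omega)

/-- The orientation of `G` against the order of a perfect list. -/
theorem IsPerfectList.isMoralOrientation [DecidableEq V] {L : List V} (h : IsPerfectList G L)
    (hL : ∀ x, x ∈ L) :
    IsMoralOrientation G ⟨fun u v => G.Adj u v ∧ L.idxOf v < L.idxOf u⟩ where
  dag := IsDAG.of_lt (α := ℕᵒᵈ) (fun v => OrderDual.toDual (L.idxOf v)) fun _ _ huv => huv.2
  adj_iff u v := by
    constructor
    · intro huv
      have : L.idxOf u ≠ L.idxOf v := fun e => huv.ne ((List.idxOf_inj (hL u)).1 e)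
      rcases this.lt_or_gt with h | h
      · exact .inr ⟨huv.symm, h⟩
      · exact .inl ⟨huv, h⟩
    · rintro (huv | huv)
      · exact huv.1
      · exact huv.1.symm
  moral a b c hab hcb hne :=
    h.adj_of_idxOf_lt (hL a) (hL c) hab.2 hcb.2 hab.1 hcb.1 hne

end PerfectList

namespace IsMoralOrientation
variable {G : SimpleGraph V} {D : Digraph V}

theorem exists_isPerfectList [Finite V] (h : IsMoralOrientation G D) :
    ∃ L, IsPerfectList G L ∧ ∀ x, x ∈ L := by
  classical
  have := Fintype.ofFinite V
  obtain ⟨r, hr⟩ := h.dag.exists_rank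
  let L := (Finset.univ : Finset V).toList.mergeSort fun a b => r b ≤ r a
  have hperm : L.Perm Finset.univ.toList := List.mergeSort_perm _ _
  have hsort : L.Pairwise fun a b => r b ≤ r a := by
    have := List.pairwise_mergeSort (le := fun a b : V => decide (r b ≤ r a))
      (fun a b c => by simp only [decide_eq_true_eq]; omega)
      (fun a b => by simp only [Bool.or_eq_true, decide_eq_true_eq]; omega)
      (Finset.univ : Finset V).toList
    simpa only [decide_eq_true_eq] using this
  have key : ∀ L : List V, L.Nodup → (L.Pairwise fun a b => r b ≤ r a) → IsPerfectList G L := by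
    intro L
    induction L with
    | nil => exact fun _ _ => trivial
    | cons s L ih =>
      intro hnd hp
      rw [List.nodup_cons] at hnd
      rw [List.pairwise_cons] at hp
      refine ⟨hnd.1, ih hnd.2 hp.2, ?_⟩
      have hto : ∀ a ∈ L, G.Adj s a → D.Adj a s := by
        intro a ha hsa
        refine ((h.adj_iff s a).1 hsa).resolve_left fun hsa => ?_
        exact absurd (hr _ _ hsa) (hp.1 a ha).not_gt
      intro a ha b hb hsa hsb hne
      exact h.moral a s b (hto a ha hsa) (hto b hb hsb) hne
  refine ⟨L, key L ?_ hsort, fun x => ?_⟩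
  · exact hperm.nodup_iff.2 (Finset.nodup_toList _)
  · rw [hperm.mem_iff]; simp

/-- A graph with a moral orientation has moral orientations with any prescribed source. -/
theorem exists_source [Finite V] (h : IsMoralOrientation G D) (v : V) :
    ∃ D', IsMoralOrientation G D' ∧ ∀ u, ¬ D'.Adj u v := by
  classical
  obtain ⟨L, hL, hmem⟩ := h.exists_isPerfectList
  obtain ⟨L', hL', hiff⟩ := hL.exists_suffix (l := [v]) (by simp) (fun _ _ => hmem _) (by simp)
  refine ⟨_, hL'.isMoralOrientation fun x => (hiff x).2 (hmem x), ?_⟩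
  rintro u ⟨-, hu⟩
  have hv : v ∉ L' := fun hv => List.disjoint_of_nodup_append hL'.nodup hv (by simp)
  have h1 := List.idxOf_lt_length_of_mem ((hiff u).2 (hmem u))
  rw [List.idxOf_append_of_notMem hv] at hu
  simp only [List.length_append, List.length_singleton, List.idxOf_cons_self] at h1 hu
  omega

end IsMoralOrientation

/-- The Markov equivalence class represented by an undirected graph consists of the moral
orientations of this graph. -/
theorem mem_markovClass_ofUndirected [Finite V] {G : SimpleGraph V} {D : Digraph V} :
    D ∈ markovClass (ofUndirected G) ↔ IsMoralOrientation G D := by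
  constructor
  · rintro ⟨hD, he⟩
    have hdir : ∀ u v, ¬ ((skeleton D).Adj u v ∧
        ∀ D', IsDAG D' → MarkovEquiv D D' → D'.Adj u v) := by
      intro u v huv
      have : (essentialGraph D).dir u v := huv
      rw [he] at this
      exact this
    have hskel : skeleton D = G := by
      ext u v
      have e : G.Adj u v ↔ (essentialGraph D).undir u v := by rw [he]; rfl
      rw [e]
      constructor
      · intro huv
        exact ⟨huv, fun h => hdir u v ⟨huv, h⟩, fun h => hdir v u ⟨huv.symm, h⟩⟩
      · exact fun h => h.1
    refine ⟨hD, fun u v => ?_, fun a b c hab hcb hne => ?_⟩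
    · rw [← hskel, skeleton_adj, and_iff_right_iff_imp]
      rintro hh rfl
      exact hD.irrefl u (hh.elim id id)
    · by_contra hac
      rw [← hskel] at hac
      refine hdir a b ⟨⟨fun e => hD.irrefl b (e ▸ hab), .inl hab⟩, fun D' hD' hDD' => ?_⟩
      exact (hDD'.collider hD hD' hab hcb hne hac).1
  · intro h
    have hno : ∀ u v, (skeleton D).Adj u v →
        ¬ ∀ D', IsDAG D' → MarkovEquiv D D' → D'.Adj u v := by
      intro u v _ hall
      obtain ⟨D', hD', hs⟩ := h.exists_source v
      exact hs u (hall D' hD'.dag (h.markovEquiv hD'))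
    refine ⟨h.dag, ?_⟩
    ext u v
    · exact ⟨fun huv => hno u v huv.1 huv.2, False.elim⟩
    · have : (ofUndirected G).undir u v ↔ (skeleton D).Adj u v := by rw [h.skeleton_eq]; rfl
      rw [this]
      exact ⟨fun huv => huv.1, fun huv => ⟨huv, hno u v huv, hno v u huv.symm⟩⟩

theorem size_ofUndirected [Finite V] (G : SimpleGraph V) :
    size (ofUndirected G) = {D | IsMoralOrientation G D}.ncard := by
  rw [size]
  congr 1
  ext D
  exact mem_markovClass_ofUndirected

section Extend
variable {K : SimpleGraph V} {m : ℕ}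

@[simp] theorem extend_inl_inl {u v : V} : (extend K m).Adj (.inl u) (.inl v) ↔ K.Adj u v := by
  simp only [extend, SimpleGraph.fromRel_adj, ne_eq, Sum.inl.injEq]
  exact ⟨fun h => h.2.elim id fun h => h.symm, fun h => ⟨h.ne, .inl h⟩⟩

@[simp] theorem extend_inl_inr {u : V} {i : Fin m} : (extend K m).Adj (.inl u) (.inr i) := by
  simp [extend]

@[simp] theorem extend_inr_inl {u : V} {i : Fin m} : (extend K m).Adj (.inr i) (.inl u) := by
  simp [extend]

@[simp] theorem extend_inr_inr {i k : Fin m} :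
    (extend K m).Adj (.inr i) (.inr k) ↔ i ≠ k := by
  simp [extend]

/-- The ways to place the vertices of an oriented graph between `m` linearly ordered dominating
vertices: only a clique may precede the last dominating vertex. -/
structure IsLevel (K : SimpleGraph V) (D : Digraph V) (m : ℕ) (j : V → Fin (m + 1)) : Prop where
  mono : ∀ u v, D.Adj u v → j u ≤ j v
  clique : ∀ u v, (j u : ℕ) < m → (j v : ℕ) < m → u ≠ v → K.Adj u v

/-- The orientation of the extended graph given by an order of the dominating vertices, an
orientation of the graph, and the positions of its vertices. -/
def glue (σ : Equiv.Perm (Fin m)) (D : Digraph V) (j : V → Fin (m + 1)) :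
    Digraph (V ⊕ Fin m) where
  Adj
    | .inl u, .inl v => D.Adj u v
    | .inl u, .inr i => (j u : ℕ) ≤ σ i
    | .inr i, .inl u => (σ i : ℕ) < j u
    | .inr i, .inr k => σ i < σ k

theorem glue_isMoralOrientation [Finite V] {D : Digraph V} (hD : IsMoralOrientation K D)
    {j : V → Fin (m + 1)} (hj : IsLevel K D m j) (σ : Equiv.Perm (Fin m)) :
    IsMoralOrientation (extend K m) (glue σ D j) where
  dag := by
    obtain ⟨r, hr⟩ := hD.dag.exists_rank
    refine IsDAG.of_lt (α := ℕ ×ₗ WithTop ℕ) (Sum.elim (fun v => toLex ((j v : ℕ), (r v : WithTop ℕ)))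
      fun i => toLex ((σ i : ℕ), ⊤)) ?_
    rintro (u | i) (v | k) h <;> simp only [glue] at h <;>
      simp only [Sum.elim_inl, Sum.elim_inr, Prod.Lex.toLex_lt_toLex]
    · have h1 := hj.mono u v h
      have h2 := hr u v h
      rw [Fin.le_def] at h1
      rcases h1.lt_or_eq with h1 | h1
      · exact .inl h1
      · exact .inr ⟨h1, by exact_mod_cast h2⟩
    · rcases h.lt_or_eq with h1 | h1
      · exact .inl h1
      · exact .inr ⟨h1, WithTop.coe_lt_top _⟩
    · exact .inl h
    · exact .inl h
  adj_iff := by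
    rintro (u | i) (v | k) <;> simp only [glue, extend_inl_inl, extend_inl_inr, extend_inr_inl,
      extend_inr_inr]
    · exact hD.adj_iff u v
    · simp only [true_iff]; omega
    · simp only [true_iff]; omega
    · rw [← σ.injective.ne_iff, ← lt_or_lt_iff_ne]
  moral := by
    have hlt : ∀ {n : ℕ} {i : Fin m}, n ≤ σ i → n < m := fun h => h.trans_lt (σ _).2
    rintro (a | a) (b | b) (c | c) hab hcb hne <;> simp only [glue] at hab hcb <;>
      simp only [extend_inl_inl, extend_inl_inr, extend_inr_inl, extend_inr_inr]
    · exact hD.moral a b c hab hcb fun e => hne (e ▸ rfl)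
    · exact hj.clique a c (hlt hab) (hlt hcb) fun e => hne (e ▸ rfl)
    · exact fun e => hne (e ▸ rfl)
    · exact fun e => hne (e ▸ rfl)

theorem perm_eq_of_lt_iff {σ τ : Equiv.Perm (Fin m)} (h : ∀ i k, σ i < σ k ↔ τ i < τ k) :
    σ = τ := by
  have e : ∀ (ρ : Equiv.Perm (Fin m)) i, (ρ i : ℕ) = (Finset.univ.filter fun k => ρ k < ρ i).card := by
    intro ρ i
    rw [← Finset.card_map ρ.toEmbedding]
    rw [← Fin.card_Iio (ρ i)]
    congr 1
    ext k
    simp only [Finset.mem_Iio, Finset.mem_map, Finset.mem_filter, Finset.mem_univ, true_and,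
      Equiv.coe_toEmbedding]
    exact ⟨fun hk => ⟨ρ.symm k, by simpa using hk, by simp⟩, by rintro ⟨k, hk, rfl⟩; exact hk⟩
  ext i
  rw [e σ i, e τ i]
  simp only [h]

theorem glue_injective {σ τ : Equiv.Perm (Fin m)} {D D' : Digraph V} {j j' : V → Fin (m + 1)}
    (h : glue σ D j = glue τ D' j') : σ = τ ∧ D = D' ∧ j = j' := by
  have hadj : ∀ x y, (glue σ D j).Adj x y ↔ (glue τ D' j').Adj x y := fun x y => by rw [h]
  have hσ : σ = τ := perm_eq_of_lt_iff fun i k => hadj (.inr i) (.inr k)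
  refine ⟨hσ, ?_, ?_⟩
  · ext u v
    exact hadj (.inl u) (.inl v)
  · subst hσ
    funext v
    have key : ∀ n : Fin m, (n : ℕ) < j v ↔ (n : ℕ) < j' v := by
      intro n
      have := hadj (.inr (σ.symm n)) (.inl v)
      simpa [glue] using this
    apply Fin.ext
    apply le_antisymm
    · by_contra hlt
      push Not at hlt
      have := (key ⟨j' v, by omega⟩).1 hlt
      exact lt_irrefl _ this
    · by_contra hlt
      push Not at hlt
      have := (key ⟨j v, by omega⟩).2 hlt
      exact lt_irrefl _ this

/-- A strict linear order on a finite type is induced by an enumeration. -/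
theorem exists_equiv_lt_iff {α : Type*} [Fintype α] {n : ℕ} (hα : Fintype.card α = n)
    {r : α → α → Prop} (hirr : ∀ i, ¬ r i i)
    (htr : ∀ i k l, r i k → r k l → r i l) (htot : ∀ i k, i ≠ k → r i k ∨ r k i) :
    ∃ σ : α ≃ Fin n, ∀ i k, r i k ↔ σ i < σ k := by
  classical
  have hlt : ∀ i, (Finset.univ.filter fun k => r k i).card < n := by
    intro i
    rw [← hα]
    exact Finset.card_lt_card (Finset.filter_ssubset.2 ⟨i, Finset.mem_univ _, hirr i⟩)
  let g : α → Fin n := fun i => ⟨_, hlt i⟩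
  have hg : ∀ i k, r i k → g i < g k := by
    intro i k hik
    show (Finset.univ.filter fun l => r l i).card < (Finset.univ.filter fun l => r l k).card
    refine Finset.card_lt_card (Finset.ssubset_iff_of_subset ?_ |>.2 ⟨i, ?_, ?_⟩)
    · intro l; simpa using fun hl => htr l i k hl hik
    · simpa using hik
    · simpa using hirr i
  have hinj : Function.Injective g := by
    intro i k hik
    by_contra hne
    rcases htot i k hne with h | h
    · exact (hg _ _ h).ne hik
    · exact (hg _ _ h).ne' hik
  have hbij : Function.Bijective g :=
    (Fintype.bijective_iff_injective_and_card g).2 ⟨hinj, by simpa using hα⟩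
  refine ⟨Equiv.ofBijective g hbij, fun i k => ⟨hg i k, fun hik => ?_⟩⟩
  have hne : i ≠ k := by rintro rfl; exact lt_irrefl _ hik
  refine (htot i k hne).resolve_right fun h => ?_
  exact lt_asymm hik (hg _ _ h)

theorem exists_threshold (P : Fin m → Prop) (hP : ∀ i k, k < i → P i → P k) :
    ∃ n : Fin (m + 1), ∀ i, P i ↔ (i : ℕ) < n := by
  classical
  have hex : ∃ n : ℕ, ∀ i : Fin m, n ≤ (i : ℕ) → ¬ P i := ⟨m, fun i hi => absurd i.2 (by omega)⟩
  have hle : Nat.find hex ≤ m := Nat.find_min' hex fun i hi => absurd i.2 (by omega)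
  refine ⟨⟨Nat.find hex, by omega⟩, fun i => ⟨fun hi => ?_, fun hi => ?_⟩⟩
  · by_contra hlt
    exact Nat.find_spec hex i (by simpa using hlt) hi
  · have hmin := Nat.find_min hex (m := i) hi
    push Not at hmin
    obtain ⟨k, hk, hPk⟩ := hmin
    rcases (Fin.le_def.2 hk).lt_or_eq with h | h
    · exact hP k i h hPk
    · rw [h]; exact hPk

theorem exists_glue {D : Digraph (V ⊕ Fin m)} (h : IsMoralOrientation (extend K m) D) :
    ∃ σ D₀ j, IsMoralOrientation K D₀ ∧ IsLevel K D₀ m j ∧ glue σ D₀ j = D := by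
  have hasymm : ∀ {x y}, D.Adj x y → ¬ D.Adj y x := fun h' => h.not_adj h'
  have htri : ∀ {x y z}, (extend K m).Adj x z → D.Adj x y → D.Adj y z → D.Adj x z := by
    intro x y z hxz hxy hyz
    refine ((h.adj_iff x z).1 hxz).resolve_right fun hzx => ?_
    exact h.dag x ((Relation.TransGen.single hxy).tail hyz |>.tail hzx)
  obtain ⟨σ, hσ⟩ := exists_equiv_lt_iff (Fintype.card_fin m) (r := fun i k : Fin m => D.Adj (.inr i) (.inr k))
    (fun i => h.dag.irrefl _)
    (fun i k l hik hkl => htri (extend_inr_inr.2 fun e => hasymm hik (e ▸ hkl)) hik hkl)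
    (fun i k hne => (h.adj_iff _ _).1 (extend_inr_inr.2 hne))
  have hthr : ∀ v : V, ∃ n : Fin (m + 1), ∀ i, D.Adj (.inr (σ.symm i)) (.inl v) ↔ (i : ℕ) < n := by
    intro v
    refine exists_threshold _ fun i k hki hi => ?_
    refine htri extend_inr_inl ((hσ (σ.symm k) (σ.symm i)).2 (by simpa using hki)) hi
  choose j hj using hthr
  have hj1 : ∀ i v, D.Adj (.inr i) (.inl v) ↔ (σ i : ℕ) < j v := fun i v => by
    simpa using hj v (σ i)
  have hj2 : ∀ i v, D.Adj (.inl v) (.inr i) ↔ (j v : ℕ) ≤ σ i := by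
    intro i v
    rw [← not_lt, ← hj1]
    exact ⟨fun h' => hasymm h', fun h' =>
      ((h.adj_iff (.inl v) (.inr i)).1 extend_inl_inr).resolve_right h'⟩
  have hglue : glue σ ⟨fun u v => D.Adj (.inl u) (.inl v)⟩ j = D := by
    ext (u | i) (v | k)
    · rfl
    · exact (hj2 _ _).symm
    · exact (hj1 _ _).symm
    · exact (hσ _ _).symm
  refine ⟨σ, ⟨fun u v => D.Adj (.inl u) (.inl v)⟩, j, ⟨?_, ?_, ?_⟩, ⟨?_, ?_⟩, hglue⟩
  · intro v hv
    exact h.dag (.inl v) (Relation.TransGen.lift Sum.inl (fun _ _ h => h) v v hv)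
  · intro u v
    rw [← extend_inl_inl (m := m), h.adj_iff]
  · intro a b c hab hcb hne
    exact extend_inl_inl.1 (h.moral _ _ _ hab hcb (by simpa using hne))
  · intro u v huv
    by_contra hlt
    rw [not_le, Fin.lt_def] at hlt
    have hvm : (j v : ℕ) < m := by omega
    have h1 : D.Adj (.inl v) (.inr (σ.symm ⟨j v, hvm⟩)) := (hj2 _ _).2 (by simp)
    have h2 : D.Adj (.inr (σ.symm ⟨j v, hvm⟩)) (.inl u) := (hj1 _ _).2 (by simpa using hlt)
    exact hasymm huv (htri (h.adj' huv) h1 h2)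
  · intro u v hu hv hne
    have hm : m - 1 < m := by omega
    have h1 : ∀ w, (j w : ℕ) < m → D.Adj (.inl w) (.inr (σ.symm ⟨m - 1, hm⟩)) :=
      fun w hw => (hj2 _ _).2 (by simp; omega)
    exact extend_inl_inl.1 (h.moral _ _ _ (h1 u hu) (h1 v hv) (by simpa using hne))

theorem f_eq [Fintype V] [Fintype {D // IsMoralOrientation K D}] (m : ℕ) :
    f K m = (∑ D : {D // IsMoralOrientation K D}, Nat.card {j // IsLevel K D.1 m j}) * m ! := by
  classical
  rw [f, size_ofUndirected, ← Nat.card_coe_set_eq, ← Nat.card_sigma]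
  have hperm : m ! = Nat.card (Equiv.Perm (Fin m)) := by
    rw [Nat.card_eq_fintype_card, Fintype.card_perm, Fintype.card_fin]
  rw [hperm, ← Nat.card_prod]
  symm
  refine Nat.card_congr (Equiv.ofBijective
    (fun x => ⟨glue x.2 x.1.1.1 x.1.2.1, glue_isMoralOrientation x.1.1.2 x.1.2.2 x.2⟩) ⟨?_, ?_⟩)
  · rintro ⟨⟨⟨D, hD⟩, j, hj⟩, σ⟩ ⟨⟨⟨D', hD'⟩, j', hj'⟩, σ'⟩ he
    obtain ⟨rfl, rfl, rfl⟩ := glue_injective (Subtype.ext_iff.1 he)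
    rfl
  · rintro ⟨D, hD⟩
    obtain ⟨σ, D₀, j, h1, h2, rfl⟩ := exists_glue hD
    exact ⟨⟨⟨⟨D₀, h1⟩, j, h2⟩, σ⟩, rfl⟩

end Extend

theorem card_fin_orderHom (m k : ℕ) : Nat.card (Fin k →o Fin m) = m.multichoose k := by
  rw [← Fintype.card_fin m, ← Sym.card_sym_eq_multichoose, Fintype.card_fin,
    ← Nat.card_eq_fintype_card]
  refine Nat.card_congr (Equiv.ofBijective
    (fun g => ⟨(List.ofFn g : Multiset (Fin m)), by simp⟩) ⟨?_, ?_⟩)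
  · intro g g' h
    have hp : (List.ofFn g).Perm (List.ofFn g') := Multiset.coe_eq_coe.1 (Subtype.ext_iff.1 h)
    have hs : ∀ g : Fin k →o Fin m, (List.ofFn g).Pairwise (· ≤ ·) := fun g =>
      List.pairwise_ofFn.2 fun _ _ hij => g.monotone hij.le
    have := hp.eq_of_pairwise (fun _ _ _ _ => le_antisymm) (hs g) (hs g')
    exact DFunLike.coe_injective (List.ofFn_injective this)
  · rintro ⟨s, hs⟩
    have hlen : (s.sort (· ≤ ·)).length = k := by simpa using hs
    subst hlen
    refine ⟨⟨(s.sort (· ≤ ·)).get, (Multiset.pairwise_sort s (· ≤ ·)).sortedLE.monotone_get⟩, ?_⟩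
    apply Subtype.ext
    change ((List.ofFn (s.sort (· ≤ ·)).get : List (Fin m)) : Multiset (Fin m)) = s
    rw [List.ofFn_get, Multiset.sort_eq]

/-- A clique which receives no edges from outside. -/
structure IsInitialClique (D : Digraph V) (K : SimpleGraph V) (S : Finset V) : Prop where
  clique : ∀ u ∈ S, ∀ v ∈ S, u ≠ v → K.Adj u v
  initial : ∀ v ∈ S, ∀ u, D.Adj u v → u ∈ S

theorem card_monotone_on_clique {K : SimpleGraph V} {D : Digraph V} (hD : IsMoralOrientation K D)
    {S : Finset V} (hS : ∀ u ∈ S, ∀ v ∈ S, u ≠ v → K.Adj u v) (m : ℕ) :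
    Nat.card {g : S → Fin m // ∀ u v : S, D.Adj u v → g u ≤ g v} = m.multichoose S.card := by
  obtain ⟨σ, hσ⟩ := exists_equiv_lt_iff (Fintype.card_coe S) (r := fun u v : S => D.Adj u v)
    (fun u => hD.dag.irrefl _)
    (fun u v w huv hvw => by
      have hne : (u : V) ≠ w := fun e => hD.not_adj huv (e ▸ hvw)
      refine ((hD.adj_iff u w).1 (hS u u.2 w w.2 hne)).resolve_right fun hwu => ?_
      exact hD.dag u ((Relation.TransGen.single huv).tail hvw |>.tail hwu))
    (fun u v hne => (hD.adj_iff u v).1 (hS u u.2 v v.2 fun e => hne (Subtype.ext e)))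
  rw [← card_fin_orderHom]
  refine Nat.card_congr
    { toFun := fun g => ⟨fun i => g.1 (σ.symm i), fun i k hik => ?_⟩
      invFun := fun g => ⟨fun u => g (σ u), fun u v huv => g.monotone ((hσ u v).1 huv).le⟩
      left_inv := fun g => Subtype.ext (funext fun u => congrArg g.1 (σ.symm_apply_apply u))
      right_inv := fun g =>
        OrderHom.ext _ _ (funext fun i => congrArg g (σ.apply_symm_apply i)) }
  rcases hik.lt_or_eq with h | rfl
  · exact g.2 _ _ ((hσ _ _).2 (by simpa using h))
  · exact le_rfl

theorem card_isLevel [Fintype V] {K : SimpleGraph V} {D : Digraph V}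
    (hD : IsMoralOrientation K D) (m : ℕ) [Fintype {S // IsInitialClique D K S}] :
    Nat.card {j // IsLevel K D m j} =
      ∑ S : {S // IsInitialClique D K S}, m.multichoose S.1.card := by
  classical
  rw [Finset.sum_congr rfl fun S _ => (card_monotone_on_clique hD S.2.clique m).symm,
    ← Nat.card_sigma]
  symm
  let F : (Σ S : {S // IsInitialClique D K S}, {g : S.1 → Fin m //
      ∀ u v : S.1, D.Adj u v → g u ≤ g v}) → V → Fin (m + 1) := fun x v =>
    if h : v ∈ x.1.1 then (x.2.1 ⟨v, h⟩).castSucc else Fin.last m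
  have hF : ∀ x v, (F x v : ℕ) < m ↔ v ∈ x.1.1 := by
    intro x v
    by_cases h : v ∈ x.1.1 <;> simp [F, h]
  have hF' : ∀ x v (h : v ∈ x.1.1), F x v = (x.2.1 ⟨v, h⟩).castSucc := by
    intro x v h
    simp [F, h]
  refine Nat.card_congr (Equiv.ofBijective (fun x => ⟨F x, ?_, ?_⟩) ⟨?_, ?_⟩)
  · intro u v huv
    by_cases hv : v ∈ x.1.1
    · have hu := x.1.2.initial v hv u huv
      rw [hF' x v hv, hF' x u hu]
      exact Fin.castSucc_le_castSucc_iff.2 (x.2.2 _ _ huv)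
    · simp only [F, hv, dif_neg, not_false_eq_true]
      exact Fin.le_last _
  · intro u v hu hv
    exact x.1.2.clique u ((hF x u).1 hu) v ((hF x v).1 hv)
  · rintro ⟨⟨S, hS⟩, g, hg⟩ ⟨⟨S', hS'⟩, g', hg'⟩ h
    have h : F ⟨⟨S, hS⟩, g, hg⟩ = F ⟨⟨S', hS'⟩, g', hg'⟩ := Subtype.ext_iff.1 h
    obtain rfl : S = S' := by
      ext v
      rw [← hF ⟨⟨S, hS⟩, g, hg⟩ v, h, hF]
    obtain rfl : g = g' := by
      ext ⟨v, hv⟩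
      have := congrFun h v
      rw [hF' _ v hv, hF' _ v hv] at this
      exact congrArg Fin.val (Fin.castSucc_injective _ this)
    rfl
  · rintro ⟨j, hj⟩
    let S : Finset V := Finset.univ.filter fun v => (j v : ℕ) < m
    have hmem : ∀ v, v ∈ S ↔ (j v : ℕ) < m := by simp [S]
    refine ⟨⟨⟨S, ?_, ?_⟩, fun v => ⟨j v, (hmem v).1 v.2⟩, fun u v huv => hj.mono u v huv⟩, ?_⟩
    · intro u hu v hv
      exact hj.clique u v ((hmem u).1 hu) ((hmem v).1 hv)
    · intro v hv u huv
      exact (hmem u).2 (lt_of_le_of_lt (hj.mono u v huv) ((hmem v).1 hv))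
    · apply Subtype.ext
      funext v
      by_cases hv : v ∈ S
      · exact hF' _ v hv
      · have h1 : j v = Fin.last m := by
          apply Fin.ext
          have := (hmem v).not.1 hv
          simp only [Fin.val_last]; omega
        simp only [F, hv, dif_neg, not_false_eq_true, h1]

theorem cast_multichoose_two (m : ℕ) : (m.multichoose 2 : ℝ) = m * (m + 1) / 2 := by
  induction m with
  | zero => simp
  | succ m ih =>
    rw [Nat.multichoose_succ_succ, Nat.cast_add, ih, Nat.multichoose_one_right]
    push_cast; ring

theorem cast_multichoose_three (m : ℕ) :
    (m.multichoose 3 : ℝ) = m * (m + 1) * (m + 2) / 6 := by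
  induction m with
  | zero => simp
  | succ m ih =>
    rw [Nat.multichoose_succ_succ, Nat.cast_add, ih, cast_multichoose_two]
    push_cast; ring

/-- The number of levels when there are no initial cliques with more than three vertices. -/
theorem card_isLevel_of_cliques [Fintype V] {K : SimpleGraph V} {D : Digraph V}
    (hD : IsMoralOrientation K D) (m : ℕ) (B₁ B₂ B₃ : Finset (Finset V))
    (h₁ : ∀ S ∈ B₁, S.card = 1) (h₂ : ∀ S ∈ B₂, S.card = 2) (h₃ : ∀ S ∈ B₃, S.card = 3)
    (h : ∀ S, IsInitialClique D K S ↔ S = ∅ ∨ S ∈ B₁ ∨ S ∈ B₂ ∨ S ∈ B₃) :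
    Nat.card {j // IsLevel K D m j} =
      1 + B₁.card * m + B₂.card * m.multichoose 2 + B₃.card * m.multichoose 3 := by
  classical
  rw [card_isLevel hD]
  have hT : ∀ S, S ∈ ({∅} ∪ B₁ ∪ B₂ ∪ B₃ : Finset (Finset V)) ↔ IsInitialClique D K S := by
    intro S
    rw [h]
    simp only [Finset.mem_union, Finset.mem_singleton, or_assoc]
  rw [← Finset.sum_subtype _ hT fun S => m.multichoose S.card]
  rw [Finset.sum_union, Finset.sum_union, Finset.sum_union, Finset.sum_singleton,
    Finset.sum_congr rfl fun S hS => congrArg m.multichoose (h₁ S hS),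
    Finset.sum_congr rfl fun S hS => congrArg m.multichoose (h₂ S hS),
    Finset.sum_congr rfl fun S hS => congrArg m.multichoose (h₃ S hS)]
  · simp
  all_goals
    rw [Finset.disjoint_left]
    intro S hS hS'
    simp only [Finset.mem_union, Finset.mem_singleton] at hS
  · subst hS
    exact absurd (h₁ _ hS') (by simp)
  · rcases hS with rfl | hS
    · exact absurd (h₂ _ hS') (by simp)
    · exact absurd (h₁ _ hS) (by rw [h₂ _ hS']; simp)
  · rcases hS with (rfl | hS) | hS
    · exact absurd (h₃ _ hS') (by simp)
    · exact absurd (h₁ _ hS) (by rw [h₃ _ hS']; simp)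
    · exact absurd (h₂ _ hS) (by rw [h₃ _ hS']; simp)

/-- A vertex without incoming edges. -/
def IsSource (D : Digraph V) (r : V) : Prop :=
  ∀ u, ¬ D.Adj u r

theorem IsDAG.exists_isSource [Finite V] [Nonempty V] {D : Digraph V} (h : IsDAG D) :
    ∃ r, IsSource D r := by
  obtain ⟨r, hr⟩ := h.exists_rank
  obtain ⟨v, hv⟩ := Finite.exists_min r
  exact ⟨v, fun u hu => (hr u v hu).not_ge (hv u)⟩

namespace IsMoralOrientation
variable {G : SimpleGraph V} {D D' : Digraph V} {r : V}

theorem adj_trans (h : IsMoralOrientation G D) {x y z : V} (hxz : G.Adj x z) (hxy : D.Adj x y)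
    (hyz : D.Adj y z) : D.Adj x z := by
  refine ((h.adj_iff x z).1 hxz).resolve_right fun hzx => ?_
  exact h.dag x ((Relation.TransGen.single hxy).tail hyz |>.tail hzx)

theorem adj_of_isSource (h : IsMoralOrientation G D) (hr : IsSource D r) {v : V}
    (hv : G.Adj r v) : D.Adj r v :=
  ((h.adj_iff r v).1 hv).resolve_right (hr v)

theorem reflTransGen_of_isSource (h : IsMoralOrientation G D) (hG : G.Connected)
    (hr : IsSource D r) (v : V) : Relation.ReflTransGen D.Adj r v := by
  have hpar : ∀ u, Relation.ReflTransGen D.Adj r u → ∀ v, D.Adj v u →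
      Relation.ReflTransGen D.Adj r v := by
    intro u hu
    induction hu with
    | refl => exact fun v hv => (hr v hv).elim
    | @tail w u hw hwu ih =>
      intro v hvu
      by_cases hvw : v = w
      · exact hvw ▸ hw
      · rcases (h.adj_iff v w).1 (h.moral v u w hvu hwu hvw) with h' | h'
        · exact ih v h'
        · exact hw.tail h'
  obtain ⟨p⟩ := hG r v
  suffices ∀ u, ∀ p : G.Walk u v, Relation.ReflTransGen D.Adj r u →
      Relation.ReflTransGen D.Adj r v from this r p .refl
  clear p
  intro u p
  induction p with
  | nil => exact id
  | cons huw _ ih =>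
    intro hu
    rcases (h.adj_iff _ _).1 huw with h' | h'
    · exact ih (hu.tail h')
    · exact ih (hpar _ hu _ h')

theorem isSource_unique (h : IsMoralOrientation G D) (hG : G.Connected) (hr : IsSource D r)
    {s : V} (hs : IsSource D s) : s = r := by
  rcases (Relation.ReflTransGen.cases_tail (h.reflTransGen_of_isSource hG hr s)) with h' | ⟨w, -, h'⟩
  · exact h'
  · exact (hs w h').elim

theorem source_mem (h : IsMoralOrientation G D) (hG : G.Connected) (hr : IsSource D r)
    {S : Finset V} (hS : IsInitialClique D G S) (hne : S ≠ ∅) : r ∈ S := by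
  obtain ⟨v, hv⟩ := Finset.nonempty_iff_ne_empty.2 hne
  have := h.reflTransGen_of_isSource hG hr v
  clear hr
  induction this using Relation.ReflTransGen.head_induction_on with
  | refl => exact hv
  | head h' _ ih => exact hS.initial _ ih _ h'

/-- An edge which is reversed in another moral orientation with the same source lies in
a triangle whose first vertex is opposite to it. -/
theorem exists_triangle_of_reversed [Finite V] (h : IsMoralOrientation G D)
    (h' : IsMoralOrientation G D') (hG : G.Connected) (hr : IsSource D r) (hr' : IsSource D' r)
    {u v : V} (huv : D.Adj u v) (hvu : D'.Adj v u) : ∃ w, D.Adj w u ∧ D.Adj w v := by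
  obtain ⟨ρ, hρ⟩ := h.dag.exists_rank
  induction hn : ρ u using Nat.strong_induction_on generalizing u v with
  | _ n ih =>
  subst hn
  have hu : u ≠ r := by rintro rfl; exact hr' v hvu
  have hpar : ∃ w, D.Adj w u := by
    rcases (Relation.ReflTransGen.cases_tail (h.reflTransGen_of_isSource hG hr u)) with e | ⟨w, -, hw⟩
    · exact (hu e).elim
    · exact ⟨w, hw⟩
  have : Nonempty {w // D.Adj w u} := nonempty_subtype.2 hpar
  obtain ⟨⟨w, hw⟩, hmin⟩ := Finite.exists_min fun w : {w // D.Adj w u} => ρ w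
  have hwu' : D'.Adj w u := by
    refine ((h'.adj_iff w u).1 (h.adj hw)).resolve_right fun hcon => ?_
    obtain ⟨t, htw, htu⟩ := ih (ρ w) (hρ _ _ hw) hw hcon rfl
    exact (hρ _ _ htw).not_ge (hmin ⟨t, htu⟩)
  have hwv : w ≠ v := by rintro rfl; exact h.not_adj huv hw
  exact ⟨w, hw, h.adj_trans (h'.moral w u v hwu' hvu hwv) hw huv⟩

end IsMoralOrientation

/-- The size is determined by the numbers of orientations and of levels for each source. -/
theorem f_eq_of_connected [Fintype V] {K : SimpleGraph V} (hK : K.Connected) (m c : ℕ) (w : V → ℕ)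
    (hc : ∀ r, {D | IsMoralOrientation K D ∧ IsSource D r}.ncard = c)
    (hw : ∀ D r, IsMoralOrientation K D → IsSource D r → Nat.card {j // IsLevel K D m j} = w r) :
    f K m = c * (∑ r, w r) * m ! := by
  classical
  have := hK.nonempty
  rw [f_eq]
  congr 1
  have hex : ∀ D : {D // IsMoralOrientation K D}, ∃ r, IsSource D.1 r := fun D =>
    D.2.dag.exists_isSource
  choose src hsrc using hex
  rw [Finset.sum_congr rfl fun D _ => hw D.1 (src D) D.2 (hsrc D),
    ← Finset.sum_fiberwise' Finset.univ src w, Finset.mul_sum]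
  refine Finset.sum_congr rfl fun r _ => ?_
  rw [Finset.sum_const, smul_eq_mul]
  congr 1
  rw [← hc r, ← Nat.card_coe_set_eq, ← Fintype.card_subtype, ← Nat.card_eq_fintype_card]
  refine Nat.card_congr ⟨fun D => ⟨D.1.1, D.1.2, by have := hsrc D.1; rwa [D.2] at this⟩,
    fun D => ⟨⟨D.1, D.2.1⟩, D.2.1.isSource_unique hK D.2.2 (hsrc ⟨D.1, D.2.1⟩)⟩, fun _ => rfl, fun _ => rfl⟩

theorem pair_image_card [DecidableEq V] {r : V} {A : Finset V} (hr : r ∉ A) :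
    (A.image fun v => ({r, v} : Finset V)).card = A.card ∧
      ∀ S ∈ A.image fun v => ({r, v} : Finset V), S.card = 2 := by
  constructor
  · refine Finset.card_image_of_injOn fun v hv w hw hvw => ?_
    have hv' : v ∈ ({r, w} : Finset V) := by
      rw [← show ({r, v} : Finset V) = {r, w} from hvw]; simp
    rcases Finset.mem_insert.1 hv' with rfl | h
    · exact (hr hv).elim
    · exact Finset.mem_singleton.1 h
  · intro S hS
    obtain ⟨v, hv, rfl⟩ := Finset.mem_image.1 hS
    exact Finset.card_pair fun e => hr (e ▸ hv)

theorem isInitialClique_empty (D : Digraph V) (G : SimpleGraph V) : IsInitialClique D G ∅ :=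
  ⟨by simp, by simp⟩

theorem IsSource.isInitialClique {D : Digraph V} {r : V} (hr : IsSource D r)
    (G : SimpleGraph V) : IsInitialClique D G {r} := by
  refine ⟨?_, ?_⟩
  · intro u hu v hv hne
    rw [Finset.mem_singleton] at hu hv
    exact (hne (hu.trans hv.symm)).elim
  · intro v hv u huv
    rw [Finset.mem_singleton] at hv
    exact (hr u (hv ▸ huv)).elim

theorem card_isLevel_of_no_triangle [Fintype V] {K : SimpleGraph V} [DecidableRel K.Adj]
    {D : Digraph V} (hK : K.Connected)
    (hD : IsMoralOrientation K D) {r : V} (hr : IsSource D r)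
    (htri : ∀ b c, K.Adj r b → K.Adj r c → ¬ K.Adj b c) (m : ℕ) :
    Nat.card {j // IsLevel K D m j} = 1 + m + K.degree r * m.multichoose 2 := by
  classical
  have hrN : r ∉ K.neighborFinset r := by simp
  rw [card_isLevel_of_cliques hD m {{r}} ((K.neighborFinset r).image fun v => {r, v}) ∅
    (by simp) (pair_image_card hrN).2 (by simp), (pair_image_card hrN).1]
  · simp
  · intro S
    simp only [Finset.mem_singleton, Finset.mem_image, SimpleGraph.mem_neighborFinset,
      Finset.notMem_empty, or_false]
    constructor
    · intro hS
      by_cases h0 : S = ∅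
      · exact .inl h0
      have hrS := hD.source_mem hK hr hS h0
      by_cases h1 : S = {r}
      · exact .inr (.inl h1)
      obtain ⟨v, hv, hvr⟩ : ∃ v ∈ S, v ≠ r := by
        by_contra hcon
        push Not at hcon
        exact h1 (Finset.eq_singleton_iff_unique_mem.2 ⟨hrS, hcon⟩)
      have hrv := hS.clique r hrS v hv hvr.symm
      refine .inr (.inr ⟨v, hrv, ?_⟩)
      ext x
      simp only [Finset.mem_insert, Finset.mem_singleton]
      refine ⟨by rintro (rfl | rfl) <;> assumption, fun hx => ?_⟩
      by_contra hcon
      push Not at hcon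
      exact htri v x hrv (hS.clique r hrS x hx hcon.1.symm) (hS.clique v hv x hx hcon.2.symm)
    · rintro (rfl | rfl | ⟨v, hv, rfl⟩)
      · exact isInitialClique_empty _ _
      · exact hr.isInitialClique K
      · refine ⟨?_, ?_⟩
        · intro a ha b hb hab
          simp only [Finset.mem_insert, Finset.mem_singleton] at ha hb
          rcases ha with rfl | rfl <;> rcases hb with rfl | rfl
          · exact (hab rfl).elim
          · exact hv
          · exact hv.symm
          · exact (hab rfl).elim
        · intro a ha b hba
          simp only [Finset.mem_insert, Finset.mem_singleton] at ha ⊢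
          rcases ha with rfl | rfl
          · exact (hr b hba).elim
          · by_contra hcon
            push Not at hcon
            exact htri _ _ hv (hD.moral _ _ _ (hD.adj_of_isSource hr hv) hba hcon.1.symm)
              (hD.adj' hba)

section Tree
variable {T : SimpleGraph V}

theorem exists_isMoralOrientation_of_isTree (hT : T.IsTree) (r : V) :
    IsMoralOrientation T ⟨fun u v => T.Adj u v ∧ T.dist r u < T.dist r v⟩ where
  dag := IsDAG.of_lt (T.dist r) fun _ _ h => h.2
  adj_iff u v := by
    constructor
    · intro h
      rcases (hT.dist_ne_of_adj r h).lt_or_gt with h' | h'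
      · exact .inl ⟨h, h'⟩
      · exact .inr ⟨h.symm, h'⟩
    · rintro (h | h)
      · exact h.1
      · exact h.1.symm
  moral a b c hab hcb hne := by
    obtain ⟨p, hp⟩ := hT.connected.exists_walk_length_eq_dist r a
    obtain ⟨q, hq⟩ := hT.connected.exists_walk_length_eq_dist r c
    have h1 := hT.dist_eq_dist_add_one_of_adj r hab.1
    have h2 := hT.dist_eq_dist_add_one_of_adj r hcb.1
    have h3 := hab.2
    have h4 := hcb.2
    have hp' := (p.concat hab.1).isPath_of_length_eq_dist
      (by rw [SimpleGraph.Walk.length_concat]; omega)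
    have hq' := (q.concat hcb.1).isPath_of_length_eq_dist
      (by rw [SimpleGraph.Walk.length_concat]; omega)
    have he := (hT.isAcyclic.subsingleton_path _ _).elim ⟨_, hp'⟩ ⟨_, hq'⟩
    have he' := congrArg (fun p : T.Path r b => p.1.penultimate) he
    simp only [SimpleGraph.Walk.penultimate_concat] at he'
    exact (hne he').elim

theorem IsAcyclic.not_triangle (hT : T.IsAcyclic) {a b c : V} (hab : T.Adj a b)
    (hbc : T.Adj b c) : ¬ T.Adj a c := by
  intro hac
  have h1 : (SimpleGraph.Walk.cons hab (.cons hbc .nil)).IsPath := by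
    simp [SimpleGraph.Walk.isPath_def, hab.ne, hbc.ne, hac.ne]
  have h2 : hac.toWalk.IsPath := by simp [SimpleGraph.Walk.isPath_def, hac.ne]
  have := congrArg (fun p : T.Path a c => p.1.length) ((hT.subsingleton_path _ _).elim ⟨_, h1⟩ ⟨_, h2⟩)
  simp at this

theorem IsAcyclic.eq_of_common_neighbor (hT : T.IsAcyclic) {a b c d : V} (hab : a ≠ b)
    (hac : T.Adj a c) (hcb : T.Adj c b) (had : T.Adj a d) (hdb : T.Adj d b) : c = d := by
  have h1 : (SimpleGraph.Walk.cons hac (.cons hcb .nil)).IsPath := by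
    simp [SimpleGraph.Walk.isPath_def, hac.ne, hcb.ne, hab]
  have h2 : (SimpleGraph.Walk.cons had (.cons hdb .nil)).IsPath := by
    simp [SimpleGraph.Walk.isPath_def, had.ne, hdb.ne, hab]
  have := congrArg (fun p : T.Path a b => p.1.snd) ((hT.subsingleton_path _ _).elim ⟨_, h1⟩ ⟨_, h2⟩)
  simpa using this

theorem f_eq_of_isTree [Fintype V] (hT : T.IsTree) (m : ℕ) :
    (f T m : ℝ) = (((Fintype.card V : ℝ) - 1) * (m : ℝ) ^ 2 +
      (2 * (Fintype.card V : ℝ) - 1) * (m : ℝ) + (Fintype.card V : ℝ)) * (m ! : ℝ) := by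
  classical
  have htri : ∀ r b c, T.Adj r b → T.Adj r c → ¬ T.Adj b c := fun r b c hrb hrc hbc =>
    IsAcyclic.not_triangle hT.isAcyclic hrb hbc hrc
  rw [f_eq_of_connected hT.connected m 1 (fun r => 1 + m + T.degree r * m.multichoose 2) ?_ ?_]
  · rw [Finset.sum_add_distrib, ← Finset.sum_mul, T.sum_degrees_eq_twice_card_edges]
    have h1 := hT.card_edgeFinset
    have h2 : (T.edgeFinset.card : ℝ) = Fintype.card V - 1 := by
      rw [← h1]; push_cast; ring
    simp only [Finset.sum_const, Finset.card_univ, smul_eq_mul]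
    push_cast
    rw [cast_multichoose_two, h2]
    ring
  · intro r
    obtain ⟨D, hD, hr⟩ := (exists_isMoralOrientation_of_isTree hT r).exists_source r
    rw [Set.ncard_eq_one]
    refine ⟨D, Set.eq_singleton_iff_unique_mem.2 ⟨⟨hD, hr⟩, ?_⟩⟩
    rintro D' ⟨hD', hr'⟩
    have key : ∀ {D₁ D₂ : Digraph V}, IsMoralOrientation T D₁ → IsMoralOrientation T D₂ →
        IsSource D₁ r → IsSource D₂ r → ∀ u v, D₁.Adj u v → D₂.Adj u v := by
      intro D₁ D₂ h₁ h₂ hr₁ hr₂ u v huv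
      refine ((h₂.adj_iff u v).1 (h₁.adj huv)).resolve_right fun hvu => ?_
      obtain ⟨w, hwu, hwv⟩ := h₁.exists_triangle_of_reversed h₂ hT.connected hr₁ hr₂ huv hvu
      exact htri w u v (h₁.adj hwu) (h₁.adj hwv) (h₁.adj huv)
    ext u v
    exact ⟨key hD' hD hr' hr u v, key hD hD' hr hr' u v⟩
  · intro D r hD hr
    exact card_isLevel_of_no_triangle hT.connected hD hr (htri r) m

end Tree

section IsEmpty

theorem f_eq_of_isEmpty [Fintype V] [IsEmpty V] (K : SimpleGraph V) (m : ℕ) : f K m = m ! := by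
  classical
  have hlev : ∀ D : {D // IsMoralOrientation K D}, Nat.card {j // IsLevel K D.1 m j} = 1 := by
    intro D
    rw [card_isLevel_of_cliques D.2 m ∅ ∅ ∅ (by simp) (by simp) (by simp)]
    · simp
    · intro S
      rw [S.eq_empty_of_isEmpty]
      simp [isInitialClique_empty]
  have : Unique {D // IsMoralOrientation K D} :=
    ⟨⟨⟨⊥, fun v => isEmptyElim v, fun v => isEmptyElim v, fun v => isEmptyElim v⟩⟩,
      fun D => Subtype.ext (Subsingleton.elim _ _)⟩
  rw [f_eq, Finset.sum_congr rfl fun D _ => hlev D]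
  simp

end IsEmpty

/-- The vertices `a`, `b`, `c` form the only triangle of `K`. -/
structure IsUniqueTriangle (K : SimpleGraph V) (a b c : V) : Prop where
  adj₁ : K.Adj a b
  adj₂ : K.Adj a c
  adj₃ : K.Adj b c
  mem : ∀ p q s, K.Adj p q → K.Adj q s → K.Adj p s → p = a ∨ p = b ∨ p = c

namespace IsUniqueTriangle
variable {K : SimpleGraph V} {a b c : V}

theorem swap₁ (h : IsUniqueTriangle K a b c) : IsUniqueTriangle K b a c :=
  ⟨h.adj₁.symm, h.adj₃, h.adj₂, fun p q s h1 h2 h3 => by have := h.mem p q s h1 h2 h3; tauto⟩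

theorem swap₂ (h : IsUniqueTriangle K a b c) : IsUniqueTriangle K a c b :=
  ⟨h.adj₂, h.adj₁, h.adj₃.symm, fun p q s h1 h2 h3 => by have := h.mem p q s h1 h2 h3; tauto⟩

theorem eq_third (h : IsUniqueTriangle K a b c) {s : V} (ha : K.Adj s a) (hb : K.Adj s b) :
    s = c := by
  rcases h.mem s a b ha h.adj₁ hb with rfl | rfl | rfl
  · exact (ha.ne rfl).elim
  · exact (hb.ne rfl).elim
  · rfl

theorem eq_pair (h : IsUniqueTriangle K a b c) {u v : V} (hu : K.Adj a u) (hv : K.Adj a v)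
    (huv : K.Adj u v) : (u = b ∧ v = c) ∨ (u = c ∧ v = b) := by
  have h1 := h.mem u v a huv hv.symm hu.symm
  have h2 := h.mem v u a huv.symm hu.symm hv.symm
  have := hu.ne; have := hv.ne; have := huv.ne
  grind

end IsUniqueTriangle

namespace IsMoralOrientation
variable {K : SimpleGraph V} {D : Digraph V} {a b c : V}

/-- A moral orientation orders the vertices of a triangle linearly. -/
theorem exists_ordered_triangle (h : IsMoralOrientation K D) (ht : IsUniqueTriangle K a b c) :
    ∃ x y z, IsUniqueTriangle K x y z ∧ D.Adj x y ∧ D.Adj x z ∧ D.Adj y z ∧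
      ∀ v, (v = a ∨ v = b ∨ v = c) ↔ (v = x ∨ v = y ∨ v = z) := by
  have key : ∀ {a b c}, IsUniqueTriangle K a b c → D.Adj a b →
      ∃ x y z, IsUniqueTriangle K x y z ∧ D.Adj x y ∧ D.Adj x z ∧ D.Adj y z ∧
      ∀ v, (v = a ∨ v = b ∨ v = c) ↔ (v = x ∨ v = y ∨ v = z) := by
    intro a b c ht hab
    rcases (h.adj_iff _ _).1 ht.adj₃ with hbc | hcb
    · exact ⟨a, b, c, ht, hab, h.adj_trans ht.adj₂ hab hbc, hbc, fun v => by tauto⟩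
    · rcases (h.adj_iff _ _).1 ht.adj₂ with hac | hca
      · exact ⟨a, c, b, ht.swap₂, hac, hab, hcb, fun v => by tauto⟩
      · exact ⟨c, a, b, ht.swap₂.swap₁, hca, hcb, hab, fun v => by tauto⟩
  rcases (h.adj_iff _ _).1 ht.adj₁ with hab | hba
  · exact key ht hab
  · obtain ⟨x, y, z, h1, h2, h3, h4, h5⟩ := key ht.swap₁ hba
    exact ⟨x, y, z, h1, h2, h3, h4, fun v => by rw [← h5]; tauto⟩

end IsMoralOrientation

/-- Replace the edge from `y` to `z` by the edge from `z` to `y`. -/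
def reverseEdge (D : Digraph V) (y z : V) : Digraph V where
  Adj u v := (D.Adj u v ∧ ¬ (u = y ∧ v = z)) ∨ (u = z ∧ v = y)

section UniqueTriangle
variable {K : SimpleGraph V} {D : Digraph V} {x y z r : V}

theorem IsMoralOrientation.reverseEdge [Finite V] (h : IsMoralOrientation K D)
    (ht : IsUniqueTriangle K x y z) (hxy : D.Adj x y) (hxz : D.Adj x z) (hyz : D.Adj y z) :
    IsMoralOrientation K (reverseEdge D y z) := by
  have hpy : ∀ s, D.Adj s y → s = x := by
    intro s hs
    by_contra hne
    have := ht.eq_third (h.moral s y x hs hxy hne) (h.adj hs)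
    subst this
    exact h.not_adj hyz hs
  have hpz : ∀ s, D.Adj s z → s = x ∨ s = y := by
    intro s hs
    by_contra hne
    push Not at hne
    exact hne.2 (ht.swap₂.eq_third (h.moral s z x hs hxz hne.1) (h.adj hs))
  refine ⟨?_, ?_, ?_⟩
  · classical
    obtain ⟨ρ, hρ⟩ := h.dag.exists_rank
    have h1 := hρ _ _ hxy
    have h2 := hρ _ _ hyz
    have h3 := ht.adj₃.ne
    refine IsDAG.of_lt (fun v => if v = z then 2 * ρ x + 1 else 2 * ρ v) ?_
    rintro u v (⟨huv, hne⟩ | ⟨rfl, rfl⟩)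
    · have h4 := hρ _ _ huv
      by_cases hv : v = z
      · subst hv
        rcases hpz u huv with rfl | rfl
        · have := ht.adj₂.ne
          simp only [if_neg this, if_true]
          omega
        · simp at hne
      · by_cases hu : u = z
        · subst hu
          simp only [if_neg hv, if_true]
          omega
        · simp only [if_neg hv, if_neg hu]
          omega
    · simp only [if_neg h3, if_true]
      omega
  · intro u v
    rw [h.adj_iff]
    simp only [MarkovSize.reverseEdge]
    constructor
    · rintro (huv | huv)
      · by_cases he : u = y ∧ v = z
        · exact .inr (.inr ⟨he.2, he.1⟩)
        · exact .inl (.inl ⟨huv, he⟩)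
      · by_cases he : v = y ∧ u = z
        · exact .inl (.inr ⟨he.2, he.1⟩)
        · exact .inr (.inl ⟨huv, he⟩)
    · rintro ((huv | ⟨rfl, rfl⟩) | (huv | ⟨rfl, rfl⟩))
      · exact .inl huv.1
      · exact .inr hyz
      · exact .inr huv.1
      · exact .inl hyz
  · rintro p q s (hpq | ⟨rfl, rfl⟩) (hsq | ⟨hs, hq⟩) hne
    · exact h.moral p q s hpq.1 hsq.1 hne
    · subst hs hq
      rw [hpy p hpq.1]
      exact ht.adj₂
    · rw [hpy s hsq.1]
      exact ht.adj₂.symm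
    · exact (hne hs.symm).elim

theorem ncard_source_of_isUniqueTriangle [Finite V] (hK : K.Connected)
    (ht : IsUniqueTriangle K x y z) (h : IsMoralOrientation K D) (r : V) :
    {D | IsMoralOrientation K D ∧ IsSource D r}.ncard = 2 := by
  obtain ⟨D₁, h₁, hr₁⟩ := h.exists_source r
  obtain ⟨x, y, z, ht, hxy, hxz, hyz, -⟩ := h₁.exists_ordered_triangle ht
  have h₂ := h₁.reverseEdge ht hxy hxz hyz
  have hr₂ : IsSource (reverseEdge D₁ y z) r := by
    rintro u (hu | ⟨rfl, rfl⟩)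
    · exact hr₁ u hu.1
    · exact hr₁ x hxy
  rw [Set.ncard_eq_two]
  refine ⟨D₁, reverseEdge D₁ y z, fun he => ?_, ?_⟩
  · have : (reverseEdge D₁ y z).Adj z y := .inr ⟨rfl, rfl⟩
    rw [← he] at this
    exact h₁.not_adj hyz this
  · ext D'
    constructor
    · rintro ⟨h', hr'⟩
      have key : ∀ u v, D₁.Adj u v → D'.Adj v u → u = y ∧ v = z := by
        intro u v huv hvu
        obtain ⟨w, hwu, hwv⟩ := h₁.exists_triangle_of_reversed h' hK hr₁ hr' huv hvu
        have e1 := ht.mem w u v (h₁.adj hwu) (h₁.adj huv) (h₁.adj hwv)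
        have e2 := ht.mem u w v (h₁.adj' hwu) (h₁.adj hwv) (h₁.adj huv)
        have e3 := ht.mem v u w (h₁.adj' huv) (h₁.adj' hwu) (h₁.adj' hwv)
        have n1 := h₁.not_adj hwu
        have n2 := h₁.not_adj hwv
        have n3 := h₁.not_adj huv
        have i := h₁.dag.irrefl
        rcases e2 with rfl | rfl | rfl
        · rcases e1 with rfl | rfl | rfl <;> first | exact (i _ hwu).elim | exact (n1 ‹_›).elim
        · rcases e3 with rfl | rfl | rfl
          · exact (n3 hxy).elim
          · exact (i _ huv).elim
          · exact ⟨rfl, rfl⟩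
        · rcases e3 with rfl | rfl | rfl
          · exact (n3 hxz).elim
          · exact (n3 hyz).elim
          · exact (i _ huv).elim
      rcases (h'.adj_iff _ _).1 ht.adj₃ with hyz' | hzy'
      · left
        ext u v
        constructor
        · intro huv
          refine ((h₁.adj_iff _ _).1 (h'.adj huv)).resolve_right fun hvu => ?_
          obtain ⟨rfl, rfl⟩ := key _ _ hvu huv
          exact h'.not_adj huv hyz'
        · intro huv
          refine ((h'.adj_iff _ _).1 (h₁.adj huv)).resolve_right fun hvu => ?_
          obtain ⟨rfl, rfl⟩ := key _ _ huv hvu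
          exact h'.not_adj hvu hyz'
      · right
        ext u v
        constructor
        · intro huv
          rcases (h₁.adj_iff _ _).1 (h'.adj huv) with h3 | h3
          · refine .inl ⟨h3, ?_⟩
            rintro ⟨rfl, rfl⟩
            exact h'.not_adj huv hzy'
          · obtain ⟨rfl, rfl⟩ := key _ _ h3 huv
            exact .inr ⟨rfl, rfl⟩
        · rintro (⟨huv, hne⟩ | ⟨rfl, rfl⟩)
          · exact ((h'.adj_iff _ _).1 (h₁.adj huv)).resolve_right fun hvu => hne (key _ _ huv hvu)
          · exact hzy'
    · rintro (rfl | rfl)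
      · exact ⟨h₁, hr₁⟩
      · exact ⟨h₂, hr₂⟩

theorem card_isLevel_of_triangle [Fintype V] [DecidableRel K.Adj] (hK : K.Connected)
    (hD : IsMoralOrientation K D) (hr : IsSource D x) (ht : IsUniqueTriangle K x y z)
    (hyz : D.Adj y z) (m : ℕ) :
    Nat.card {j // IsLevel K D m j} =
      1 + m + (K.degree x - 1) * m.multichoose 2 + m.multichoose 3 := by
  classical
  have hrN : x ∉ (K.neighborFinset x).erase z := by simp
  have hxy := hD.adj_of_isSource hr ht.adj₁
  have hxz := hD.adj_of_isSource hr ht.adj₂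
  rw [card_isLevel_of_cliques hD m {{x}} (((K.neighborFinset x).erase z).image fun v => {x, v})
    {{x, y, z}} (by simp) (pair_image_card hrN).2
    (by simp [Finset.card_eq_three]; exact ⟨x, y, ht.adj₁.ne, z, ht.adj₂.ne, ht.adj₃.ne, rfl⟩),
    (pair_image_card hrN).1, Finset.card_erase_of_mem (by simpa using ht.adj₂)]
  · simp
  · intro S
    simp only [Finset.mem_singleton, Finset.mem_image, SimpleGraph.mem_neighborFinset,
      Finset.mem_erase]
    constructor
    · intro hS
      by_cases h0 : S = ∅
      · exact .inl h0
      have hrS := hD.source_mem hK hr hS h0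
      by_cases h1 : S = {x}
      · exact .inr (.inl h1)
      by_cases hz : z ∈ S
      · refine .inr (.inr (.inr ?_))
        have hy := hS.initial z hz y hyz
        ext w
        simp only [Finset.mem_insert, Finset.mem_singleton]
        refine ⟨fun hw => ?_, by rintro (rfl | rfl | rfl) <;> assumption⟩
        by_contra hcon
        push Not at hcon
        exact hcon.2.2 (ht.eq_third (hS.clique w hw x hrS hcon.1) (hS.clique w hw y hy hcon.2.1))
      · refine .inr (.inr (.inl ?_))
        obtain ⟨v, hv, hvr⟩ : ∃ v ∈ S, v ≠ x := by
          by_contra hcon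
          push Not at hcon
          exact h1 (Finset.eq_singleton_iff_unique_mem.2 ⟨hrS, hcon⟩)
        have hrv := hS.clique x hrS v hv hvr.symm
        refine ⟨v, ⟨fun e => hz (e ▸ hv), hrv⟩, ?_⟩
        ext w
        simp only [Finset.mem_insert, Finset.mem_singleton]
        refine ⟨by rintro (rfl | rfl) <;> assumption, fun hw => ?_⟩
        by_contra hcon
        push Not at hcon
        rcases ht.eq_pair hrv (hS.clique x hrS w hw hcon.1.symm)
          (hS.clique v hv w hw hcon.2.symm) with ⟨-, rfl⟩ | ⟨rfl, -⟩
        · exact hz hw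
        · exact hz hv
    · rintro (rfl | rfl | ⟨v, ⟨hvz, hv⟩, rfl⟩ | rfl)
      · exact isInitialClique_empty _ _
      · exact hr.isInitialClique K
      · refine ⟨?_, ?_⟩
        · intro a ha b hb hab
          simp only [Finset.mem_insert, Finset.mem_singleton] at ha hb
          rcases ha with rfl | rfl <;> rcases hb with rfl | rfl
          · exact (hab rfl).elim
          · exact hv
          · exact hv.symm
          · exact (hab rfl).elim
        · intro a ha b hba
          simp only [Finset.mem_insert, Finset.mem_singleton] at ha ⊢
          rcases ha with rfl | rfl
          · exact (hr b hba).elim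
          · by_contra hcon
            push Not at hcon
            have hxb := hD.moral _ _ _ (hD.adj_of_isSource hr hv) hba hcon.1.symm
            rcases ht.eq_pair hxb hv (hD.adj hba) with ⟨-, rfl⟩ | ⟨rfl, rfl⟩
            · exact hvz rfl
            · exact hD.not_adj hyz hba
      · refine ⟨?_, ?_⟩
        · intro a ha b hb hab
          simp only [Finset.mem_insert, Finset.mem_singleton] at ha hb
          have e1 := ht.adj₁
          have e2 := ht.adj₂
          have e3 := ht.adj₃
          rcases ha with rfl | rfl | rfl <;> rcases hb with rfl | rfl | rfl <;>
            first | exact (hab rfl).elim | assumption | (symm; assumption)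
        · intro a ha b hba
          simp only [Finset.mem_insert, Finset.mem_singleton] at ha ⊢
          by_cases hbx : b = x
          · exact .inl hbx
          rcases ha with rfl | rfl | rfl
          · exact (hr b hba).elim
          · exact .inr (.inr (ht.eq_third (hD.moral _ _ _ hba hxy hbx) (hD.adj hba)))
          · exact .inr (.inl (ht.swap₂.eq_third (hD.moral _ _ _ hba hxz hbx) (hD.adj hba)))

theorem f_eq_of_isUniqueTriangle [Fintype V] {a b c : V} (hK : K.Connected)
    (ht : IsUniqueTriangle K a b c) (h : IsMoralOrientation K D)
    (hE : K.edgeSet.ncard = Fintype.card V) (m : ℕ) :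
    (f K m : ℝ) = ((m : ℝ) ^ 3 + 2 * (Fintype.card V : ℝ) * (m : ℝ) ^ 2 +
      (4 * (Fintype.card V : ℝ) - 1) * (m : ℝ) + 2 * (Fintype.card V : ℝ)) * (m ! : ℝ) := by
  classical
  let t : V → ℕ := fun r => if r = a ∨ r = b ∨ r = c then 1 else 0
  have hdeg : ∀ r, t r ≤ K.degree r := by
    intro r
    by_cases hr : r = a ∨ r = b ∨ r = c
    · simp only [t, if_pos hr]
      refine Nat.one_le_iff_ne_zero.2 (Nat.pos_iff_ne_zero.1 ?_)
      rw [SimpleGraph.degree_pos_iff_exists_adj]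
      rcases hr with rfl | rfl | rfl
      · exact ⟨_, ht.adj₁⟩
      · exact ⟨_, ht.adj₃⟩
      · exact ⟨_, ht.adj₂.symm⟩
    · simp [t, hr]
  have hsum : ∑ r, t r = 3 := by
    rw [← Finset.card_filter, Finset.card_eq_three]
    refine ⟨a, b, c, ht.adj₁.ne, ht.adj₂.ne, ht.adj₃.ne, ?_⟩
    ext v
    simp
  rw [f_eq_of_connected hK m 2 (fun r => 1 + m + (K.degree r - t r) * m.multichoose 2 +
    t r * m.multichoose 3) (ncard_source_of_isUniqueTriangle hK ht h)]
  · have h1 := K.sum_degrees_eq_twice_card_edges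
    rw [← Set.ncard_coe_finset, SimpleGraph.coe_edgeFinset, hE] at h1
    have h1' : ∑ r, (K.degree r : ℝ) = 2 * Fintype.card V := by exact_mod_cast h1
    have hsum' : ∑ r, (t r : ℝ) = 3 := by exact_mod_cast hsum
    push_cast [Nat.cast_sub (hdeg _)]
    rw [Finset.sum_add_distrib, Finset.sum_add_distrib, ← Finset.sum_mul, ← Finset.sum_mul,
      Finset.sum_sub_distrib, h1', hsum', cast_multichoose_two, cast_multichoose_three]
    simp only [Finset.sum_const, Finset.card_univ, nsmul_eq_mul]
    ring
  · intro D r hD hr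
    by_cases hmem : r = a ∨ r = b ∨ r = c
    · obtain ⟨x, y, z, ht', hxy, hxz, hyz, hiff⟩ := hD.exists_ordered_triangle ht
      obtain rfl : r = x := by
        rcases (hiff r).1 hmem with rfl | rfl | rfl
        · rfl
        · exact (hr _ hxy).elim
        · exact (hr _ hxz).elim
      rw [card_isLevel_of_triangle hK hD hr ht' hyz]
      simp [t, hmem]
    · rw [card_isLevel_of_no_triangle hK hD hr]
      · simp [t, hmem]
      · intro u v hu hv huv
        exact hmem (ht.mem r u v hu huv hv)

end UniqueTriangle

section TreePlus
variable {K T : SimpleGraph V} {a b : V}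

theorem sup_edge_adj_iff (hab : a ≠ b) {u v : V} : (T ⊔ SimpleGraph.edge a b).Adj u v ↔
    T.Adj u v ∨ (u = a ∧ v = b) ∨ (u = b ∧ v = a) := by
  rw [SimpleGraph.sup_adj, SimpleGraph.edge_adj]
  constructor
  · tauto
  · rintro (h | ⟨rfl, rfl⟩ | ⟨rfl, rfl⟩)
    · exact .inl h
    · exact .inr ⟨.inl ⟨rfl, rfl⟩, hab⟩
    · exact .inr ⟨.inr ⟨rfl, rfl⟩, hab.symm⟩

/-- In a chordal tree plus graph, the additional edge closes a triangle. -/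
theorem exists_common_neighbor (hT : T.IsTree) (hab : a ≠ b) (hnadj : ¬ T.Adj a b)
    (hK : IsChordal (T ⊔ SimpleGraph.edge a b)) : ∃ c, T.Adj a c ∧ T.Adj c b := by
  obtain ⟨p, hp, hlen⟩ := hT.connected.exists_path_of_dist a b
  have h2 : 1 < p.length := hlen ▸ hT.connected.one_lt_dist_of_ne_of_not_adj hab hnadj
  rcases (Nat.succ_le_of_lt h2).eq_or_lt with h3 | h3
  · have e1 := p.adj_getVert_succ (i := 0) (by omega)
    have e2 := p.adj_getVert_succ (i := 1) (by omega)
    have e3 : p.getVert (1 + 1) = b := by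
      rw [show 1 + 1 = p.length from h3, SimpleGraph.Walk.getVert_length]
    rw [SimpleGraph.Walk.getVert_zero] at e1
    rw [e3] at e2
    exact ⟨_, e1, e2⟩
  · exfalso
    have hle : T ≤ T ⊔ SimpleGraph.edge a b := le_sup_left
    have hba : (T ⊔ SimpleGraph.edge a b).Adj b a := (sup_edge_adj_iff hab).2 (by simp)
    have hcyc : (SimpleGraph.Walk.cons hba (p.mapLe hle)).IsCycle := by
      rw [SimpleGraph.Walk.cons_isCycle_iff]
      refine ⟨(SimpleGraph.Walk.isPath_mapLe hle).2 hp, fun hmem => ?_⟩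
      rw [SimpleGraph.Walk.edges_mapLe_eq_edges] at hmem
      exact hnadj (p.adj_of_mem_edges hmem).symm
    obtain ⟨e, he⟩ := hK b _ hcyc (by simp; omega)
    induction e using Sym2.ind with
    | _ u v =>
    rw [SimpleGraph.Walk.isChord_sym2Mk] at he
    obtain ⟨huv, hne, hu, hv⟩ := he
    simp only [SimpleGraph.Walk.edges_cons, SimpleGraph.Walk.edges_mapLe_eq_edges,
      SimpleGraph.Walk.support_cons, SimpleGraph.Walk.support_mapLe_eq_support, List.mem_cons, not_or] at hne hu hv
    have hu' : u ∈ p.support := hu.elim (fun e => e ▸ p.end_mem_support) id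
    have hv' : v ∈ p.support := hv.elim (fun e => e ▸ p.end_mem_support) id
    have huvT : T.Adj u v := by
      rcases (sup_edge_adj_iff hab).1 huv with h | ⟨rfl, rfl⟩ | ⟨rfl, rfl⟩
      · exact h
      · exact (hne.1 Sym2.eq_swap).elim
      · exact (hne.1 rfl).elim
    obtain ⟨i, rfl, hi⟩ := SimpleGraph.Walk.mem_support_iff_exists_getVert.1 hu'
    obtain ⟨k, rfl, hk⟩ := SimpleGraph.Walk.mem_support_iff_exists_getVert.1 hv'
    have key : ∀ i k, i < k → k ≤ p.length → T.Adj (p.getVert i) (p.getVert k) →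
        s(p.getVert i, p.getVert k) ∈ p.edges := by
      intro i k hik hk hadj
      have := SimpleGraph.dist_le ((p.take i).append (.cons hadj (p.drop k)))
      simp at this
      obtain rfl : k = i + 1 := by omega
      exact SimpleGraph.Walk.adj_toSubgraph_iff_mem_edges.1 (p.toSubgraph_adj_getVert hk)
    rcases lt_trichotomy i k with h | rfl | h
    · exact hne.2 (key i k h hk huvT)
    · exact T.loopless.irrefl _ huvT
    · exact hne.2 (Sym2.eq_swap ▸ key k i h hi huvT.symm)

theorem isUniqueTriangle_sup_edge (hT : T.IsAcyclic) (hab : a ≠ b) {c : V} (hac : T.Adj a c)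
    (hcb : T.Adj c b) : IsUniqueTriangle (T ⊔ SimpleGraph.edge a b) c a b := by
  have hle : T ≤ T ⊔ SimpleGraph.edge a b := le_sup_left
  refine ⟨hle hac.symm, hle hcb, (sup_edge_adj_iff hab).2 (by simp), fun p q s hpq hqs hps => ?_⟩
  rw [sup_edge_adj_iff hab] at hpq hqs hps
  have key : ∀ d, T.Adj a d → T.Adj d b → d = c := fun d had hdb =>
    (IsAcyclic.eq_of_common_neighbor hT hab hac hcb had hdb).symm
  have hnt : ¬ (T.Adj p q ∧ T.Adj q s ∧ T.Adj p s) := fun h =>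
    IsAcyclic.not_triangle hT h.1 h.2.1 h.2.2
  have hsym : ∀ {u v}, T.Adj u v → T.Adj v u := fun h => h.symm
  grind

theorem f_eq_of_isTreePlus [Fintype V] (hK : IsChordal K) (h : IsTreePlus K) (m : ℕ) :
    (f K m : ℝ) = ((m : ℝ) ^ 3 + 2 * (Fintype.card V : ℝ) * (m : ℝ) ^ 2 +
      (4 * (Fintype.card V : ℝ) - 1) * (m : ℝ) + 2 * (Fintype.card V : ℝ)) * (m ! : ℝ) := by
  classical
  obtain ⟨T, a, b, hT, hab, hnadj, rfl⟩ := h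
  obtain ⟨c, hac, hcb⟩ := exists_common_neighbor hT hab hnadj hK
  have ht := isUniqueTriangle_sup_edge hT.isAcyclic hab hac hcb
  have hle : T ≤ T ⊔ SimpleGraph.edge a b := le_sup_left
  have hD := exists_isMoralOrientation_of_isTree hT c
  have hD' : IsMoralOrientation (T ⊔ SimpleGraph.edge a b)
      ⟨fun u v => (T.Adj u v ∧ T.dist c u < T.dist c v) ∨ (u = a ∧ v = b)⟩ := by
    have hda : T.dist c a = 1 := SimpleGraph.dist_eq_one_iff_adj.2 hac.symm
    have hdb : T.dist c b = 1 := SimpleGraph.dist_eq_one_iff_adj.2 hcb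
    have hpar : ∀ u, T.Adj u b → T.dist c u < T.dist c b → u = c := by
      intro u _ hlt
      rw [hdb, Nat.lt_one_iff, hT.connected.dist_eq_zero_iff] at hlt
      exact hlt.symm
    refine ⟨?_, ?_, ?_⟩
    · refine IsDAG.of_lt (α := ℕ) (fun v => if v = b then 2 * T.dist c v + 1 else 2 * T.dist c v) ?_
      rintro u v (⟨-, h⟩ | ⟨rfl, rfl⟩)
      · split_ifs <;> omega
      · simp only [if_neg hab, if_true]
        omega
    · intro u v
      have := hD.adj_iff u v
      rw [sup_edge_adj_iff hab, this]
      tauto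
    · rintro u v w (h1 | ⟨rfl, rfl⟩) (h2 | ⟨h2, h3⟩) hne
      · exact hle (hD.moral u v w h1 h2 hne)
      · subst h2 h3
        rw [hpar u h1.1 h1.2]
        exact hle hac.symm
      · rw [hpar w h2.1 h2.2]
        exact hle hac
      · exact (hne h2.symm).elim
  refine f_eq_of_isUniqueTriangle (hT.connected.mono hle) ht hD' ?_ m
  rw [← SimpleGraph.coe_edgeFinset, Set.ncard_coe_finset,
    SimpleGraph.card_edgeFinset_sup_edge _ hnadj hab]
  exact hT.card_edgeFinset

end TreePlus

section IsolatedEdges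
variable {K : SimpleGraph V} {D : Digraph V}

theorem IsIsolatedEdges.eq (hK : IsIsolatedEdges K) {u v w : V} (hv : K.Adj u v)
    (hw : K.Adj u w) : v = w :=
  (hK u).unique hv hw

theorem IsIsolatedEdges.isMoralOrientation (hK : IsIsolatedEdges K)
    (hadj : ∀ u v, K.Adj u v ↔ D.Adj u v ∨ D.Adj v u) (hasymm : ∀ u v, D.Adj u v → ¬ D.Adj v u) :
    IsMoralOrientation K D := by
  classical
  have h1 : ∀ {u v}, D.Adj u v → K.Adj u v := fun h => (hadj _ _).2 (.inl h)
  refine ⟨?_, hadj, fun a b c hab hcb hne => (hne (hK.eq (h1 hab).symm (h1 hcb).symm)).elim⟩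
  refine IsDAG.of_lt (α := ℕ) (fun v => if ∃ u, D.Adj u v then 1 else 0) fun u v huv => ?_
  have hu : ¬ ∃ t, D.Adj t u := by
    rintro ⟨t, ht⟩
    obtain rfl := hK.eq (h1 ht).symm (h1 huv)
    exact hasymm _ _ huv ht
  rw [if_neg hu, if_pos ⟨u, huv⟩]
  exact Nat.zero_lt_one

theorem IsMoralOrientation.isSource_iff (hD : IsMoralOrientation K D) (hK : IsIsolatedEdges K)
    {u v : V} (huv : K.Adj u v) : IsSource D u ↔ D.Adj u v := by
  refine ⟨fun hu => hD.adj_of_isSource hu huv, fun h t ht => ?_⟩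
  obtain rfl := hK.eq (hD.adj' ht) huv
  exact hD.not_adj h ht

theorem IsMoralOrientation.isSource_iff_not (hD : IsMoralOrientation K D)
    (hK : IsIsolatedEdges K) {u v : V} (huv : K.Adj u v) : IsSource D u ↔ ¬ IsSource D v := by
  rw [hD.isSource_iff hK huv, hD.isSource_iff hK huv.symm]
  exact ⟨fun h => hD.not_adj h, fun h => ((hD.adj_iff u v).1 huv).resolve_right h⟩

/-- Half of the vertices are sources. -/
theorem IsMoralOrientation.two_mul_ncard_isSource [Fintype V] (hD : IsMoralOrientation K D)
    (hK : IsIsolatedEdges K) : 2 * {v | IsSource D v}.ncard = Fintype.card V := by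
  choose w hw _ using id hK
  have hinv : ∀ v, w (w v) = v := fun v => hK.eq (hw (w v)) (hw v).symm
  have h1 : {v | IsSource D v}ᶜ = w '' {v | IsSource D v} := by
    ext v
    constructor
    · intro hv
      exact ⟨w v, by_contra fun h => hv ((hD.isSource_iff_not hK (hw v)).2 h), hinv v⟩
    · rintro ⟨u, hu, rfl⟩
      exact (hD.isSource_iff_not hK (hw u)).1 hu
  have h2 := Set.ncard_add_ncard_compl {v | IsSource D v}
  rw [h1, Set.ncard_image_of_injective _ (Function.LeftInverse.injective hinv),
    Nat.card_eq_fintype_card] at h2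
  omega

theorem card_isLevel_of_isIsolatedEdges [Fintype V] (hD : IsMoralOrientation K D)
    (hK : IsIsolatedEdges K) (m : ℕ) :
    Nat.card {j // IsLevel K D m j} =
      1 + {v | IsSource D v}.ncard * m + {v | IsSource D v}.ncard * m.multichoose 2 := by
  classical
  choose w hw _ using id hK
  let A : Finset V := Finset.univ.filter (IsSource D)
  have hA : ∀ v, v ∈ A ↔ IsSource D v := by simp [A]
  have hAc : {v | IsSource D v}.ncard = A.card := by
    rw [← Set.ncard_coe_finset]
    congr 1
    ext v
    simp [A]
  have hwA : ∀ s ∈ A, w s ∉ A := fun s hs => by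
    rw [hA] at hs ⊢
    exact (hD.isSource_iff_not hK (hw s)).1 hs
  rw [card_isLevel_of_cliques hD m (A.image fun s => {s}) (A.image fun s => {s, w s}) ∅
    ?_ ?_ (by simp) ?_, Finset.card_image_of_injective _ Finset.singleton_injective,
    Finset.card_image_of_injOn, hAc]
  · simp
  · intro s hs t ht hst
    have hmem : s ∈ ({t, w t} : Finset V) := by
      rw [← show ({s, w s} : Finset V) = {t, w t} from hst]; simp
    rcases Finset.mem_insert.1 hmem with h | h
    · exact h
    · rw [Finset.mem_singleton] at h
      exact (hwA t ht (h ▸ hs)).elim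
  · simp
  · intro S hS
    obtain ⟨s, -, rfl⟩ := Finset.mem_image.1 hS
    exact Finset.card_pair (hw s).ne
  · intro S
    simp only [Finset.mem_image, Finset.notMem_empty, or_false, hA]
    constructor
    · intro hS
      by_cases h0 : S = ∅
      · exact .inl h0
      obtain ⟨v, hv⟩ := Finset.nonempty_iff_ne_empty.2 h0
      obtain ⟨s, hsS, hs⟩ : ∃ s ∈ S, IsSource D s := by
        by_cases h : IsSource D v
        · exact ⟨v, hv, h⟩
        · have h' : IsSource D (w v) := (hD.isSource_iff_not hK (hw v).symm).2 h
          exact ⟨w v, hS.initial v hv _ (hD.adj_of_isSource h' (hw v).symm), h'⟩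
      have hsub : ∀ x ∈ S, x = s ∨ x = w s := fun x hx => by
        by_contra hcon
        push Not at hcon
        exact hcon.2 (hK.eq (hS.clique s hsS x hx hcon.1.symm) (hw s))
      by_cases h : w s ∈ S
      · refine .inr (.inr ⟨s, hs, ?_⟩)
        ext x
        simp only [Finset.mem_insert, Finset.mem_singleton]
        exact ⟨by rintro (rfl | rfl) <;> assumption, hsub x⟩
      · refine .inr (.inl ⟨s, hs, ?_⟩)
        ext x
        simp only [Finset.mem_singleton]
        refine ⟨by rintro rfl; exact hsS, fun hx => (hsub x hx).resolve_right ?_⟩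
        rintro rfl
        exact h hx
    · rintro (rfl | ⟨s, hs, rfl⟩ | ⟨s, hs, rfl⟩)
      · exact isInitialClique_empty _ _
      · exact hs.isInitialClique K
      · refine ⟨?_, ?_⟩
        · intro a ha b hb hab
          simp only [Finset.mem_insert, Finset.mem_singleton] at ha hb
          rcases ha with rfl | rfl <;> rcases hb with rfl | rfl
          · exact (hab rfl).elim
          · exact hw a
          · exact (hw b).symm
          · exact (hab rfl).elim
        · intro a ha b hba
          simp only [Finset.mem_insert, Finset.mem_singleton] at ha ⊢
          rcases ha with rfl | rfl
          · exact (hs b hba).elim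
          · exact .inl (hK.eq (hD.adj' hba) (hw s).symm)

theorem card_isMoralOrientation_of_isIsolatedEdges [Fintype V] (hK : IsIsolatedEdges K) :
    ∃ k, 2 * k = Fintype.card V ∧ Nat.card {D // IsMoralOrientation K D} = 2 ^ k := by
  classical
  let e := Fintype.equivFin V
  have h₁ : IsMoralOrientation K ⟨fun u v => K.Adj u v ∧ e u < e v⟩ := by
    refine hK.isMoralOrientation (fun u v => ?_) fun u v h h' => lt_asymm h.2 h'.2
    constructor
    · intro h
      rcases (e.injective.ne h.ne).lt_or_gt with h' | h'
      · exact .inl ⟨h, h'⟩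
      · exact .inr ⟨h.symm, h'⟩
    · rintro (h | h)
      · exact h.1
      · exact h.1.symm
  generalize (⟨fun u v => K.Adj u v ∧ e u < e v⟩ : Digraph V) = D₁ at h₁
  refine ⟨_, h₁.two_mul_ncard_isSource hK, ?_⟩
  have hcard : 2 ^ {v | IsSource D₁ v}.ncard = Nat.card (Set {v | IsSource D₁ v}) := by
    rw [← Nat.card_coe_set_eq, Nat.card_eq_fintype_card, Nat.card_eq_fintype_card,
      Fintype.card_set]
  rw [hcard]
  refine Nat.card_congr (Equiv.ofBijective (fun D => {s | IsSource D.1 s}) ⟨?_, ?_⟩)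
  · rintro ⟨D, hD⟩ ⟨D', hD'⟩ h
    have hs : ∀ s, IsSource D₁ s → (IsSource D s ↔ IsSource D' s) := fun s hs =>
      Set.ext_iff.1 h ⟨s, hs⟩
    apply Subtype.ext
    ext u v
    by_cases huv : K.Adj u v
    · rw [← hD.isSource_iff hK huv, ← hD'.isSource_iff hK huv]
      by_cases hu : IsSource D₁ u
      · exact hs u hu
      · rw [hD.isSource_iff_not hK huv, hD'.isSource_iff_not hK huv,
          hs v ((h₁.isSource_iff_not hK huv.symm).2 hu)]
    · exact iff_of_false (fun h => huv (hD.adj h)) fun h => huv (hD'.adj h)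
  · intro X
    let src : V → Prop := fun v => ∃ h : IsSource D₁ v, ⟨v, h⟩ ∈ X
    have hD : IsMoralOrientation K
        ⟨fun u v => K.Adj u v ∧ (src u ∨ (IsSource D₁ v ∧ ¬ src v))⟩ := by
      have hsrc : ∀ v, src v → IsSource D₁ v := fun v h => h.1
      refine hK.isMoralOrientation (fun u v => ?_) fun u v h h' => ?_
      · constructor
        · intro huv
          have := h₁.isSource_iff_not hK huv
          have := huv.symm
          show (_ ∧ _) ∨ (_ ∧ _)
          tauto
        · rintro (h | h)
          · exact h.1
          · exact h.1.symm
      · have := h₁.isSource_iff_not hK h.1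
        have h2 := h.2
        have h3 := h'.2
        have := hsrc u
        have := hsrc v
        tauto
    refine ⟨⟨_, hD⟩, ?_⟩
    ext ⟨s, hs⟩
    obtain ⟨t, ht, -⟩ := hK s
    have hnt := (h₁.isSource_iff_not hK ht).1 hs
    refine (hD.isSource_iff hK ht).trans ?_
    show (K.Adj s t ∧ (src s ∨ (IsSource D₁ t ∧ ¬ src t))) ↔ _
    constructor
    · rintro ⟨-, h | h⟩
      · exact h.2
      · exact (hnt h.1).elim
    · exact fun h => ⟨ht, .inl ⟨hs, h⟩⟩

theorem f_eq_of_isIsolatedEdges [Fintype V] (hK : IsIsolatedEdges K) (m : ℕ) :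
    (f K m : ℝ) = (2 : ℝ) ^ ((Fintype.card V : ℝ) / 2 - 1) *
      ((Fintype.card V : ℝ) * (m : ℝ) ^ 2 / 2 + 3 * (Fintype.card V : ℝ) * (m : ℝ) / 2 + 2) *
        (m ! : ℝ) := by
  classical
  obtain ⟨k, hk, hcard⟩ := card_isMoralOrientation_of_isIsolatedEdges hK
  have hlev : ∀ D : {D // IsMoralOrientation K D}, Nat.card {j // IsLevel K D.1 m j} =
      1 + k * m + k * m.multichoose 2 := by
    intro D
    have := D.2.two_mul_ncard_isSource hK
    rw [card_isLevel_of_isIsolatedEdges D.2 hK, show {v | IsSource D.1 v}.ncard = k by omega]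
  rw [f_eq, Finset.sum_congr rfl fun D _ => hlev D, Finset.sum_const, Finset.card_univ,
    ← Nat.card_eq_fintype_card, hcard, smul_eq_mul]
  have hk' : (Fintype.card V : ℝ) = 2 * k := by exact_mod_cast hk.symm
  rw [hk', show (2 * (k : ℝ)) / 2 - 1 = (k : ℝ) - 1 by ring, Real.rpow_sub_one (by norm_num),
    Real.rpow_natCast]
  push_cast
  rw [cast_multichoose_two]
  ring

end IsolatedEdges

end MarkovSize

theorem corollary3 {V : Type*} [Fintype V] (K : SimpleGraph V) (hK : MarkovSize.IsChordal K)
    (p : ℕ) (hp : Fintype.card V = p) :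
    -- null graph: no vertices
    (IsEmpty V → ∀ m : ℕ, MarkovSize.f K m = m !) ∧
    (K.IsTree → ∀ m : ℕ, (MarkovSize.f K m : ℝ) =
      (((p : ℝ) - 1) * (m : ℝ) ^ 2 + (2 * (p : ℝ) - 1) * (m : ℝ) + (p : ℝ)) * (m ! : ℝ)) ∧
    (MarkovSize.IsTreePlus K → ∀ m : ℕ, (MarkovSize.f K m : ℝ) =
      ((m : ℝ) ^ 3 + 2 * (p : ℝ) * (m : ℝ) ^ 2 + (4 * (p : ℝ) - 1) * (m : ℝ) + 2 * (p : ℝ)) *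
        (m ! : ℝ)) ∧
    (MarkovSize.IsIsolatedEdges K → ∀ m : ℕ, (MarkovSize.f K m : ℝ) =
      (2 : ℝ) ^ ((p : ℝ) / 2 - 1) *
        ((p : ℝ) * (m : ℝ) ^ 2 / 2 + 3 * (p : ℝ) * (m : ℝ) / 2 + 2) * (m ! : ℝ)) := by
  subst hp
  refine ⟨fun _ m => MarkovSize.f_eq_of_isEmpty K m, fun hT m => MarkovSize.f_eq_of_isTree hT m,
    fun h m => MarkovSize.f_eq_of_isTreePlus hK h m,
    fun h m => MarkovSize.f_eq_of_isIsolatedEdges h m⟩
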